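/- Let $\mathbb{H}=\{z\in\mathbb{C} : \operatorname{Im} z>0\}$. For an even integer $k\ge 4$ and $z\in\mathbb{H}$ let $$E_k(z)=\frac12\sum_{\substack{(c,d)\in\mathbb{Z}^2\\ \gcd(c,d)=1}}(cz+d)^{-k},\qquad E^*_{k,2}(z)=\frac{2^{k/2}E_k(2z)+E_k(z)}{2^{k/2}+1}$$ (the latter is the Eisenstein series of weight $k$ for the Fricke group $\Gamma_0^*(2)$), and let $$\mathbb{F}^*(2)=\{z\in\mathbb{H} : |z|\ge 1/\sqrt2,\ -1/2\le\operatorname{Re} z\le 0\}\cup\{z\in\mathbb{H} : |z|>1/\sqrt2,\ 0\le\operatorname{Re} z<1/2\}$$ be the fundamental domain for $\Gamma_0^*(2)$. Then for every even integer $k\ge4$, all zeros of $E^*_{k,2}$ in $\mathbb{F}^*(2)$ lie on the closed arc $\{z : |z|=1/\sqrt2,\ \pi/2\le\arg z\le 3\pi/4\}$. -/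

import Mathlib

open scoped UpperHalfPlane

/-- The point `2z` of the upper half-plane. -/
noncomputable def doublePoint (z : ℍ) : ℍ :=
  ⟨2 * (z : ℂ), by simpa using z.im_pos⟩

/-- The Eisenstein series of weight `k` for the Fricke group of level `2`,
`E*_{k,2}(z) = (2^{k/2} E_k(2z) + E_k(z)) / (2^{k/2} + 1)`, for `k ≥ 3`. Here
`ModularForm.E hk` is `E_k(z) = (1/2) ∑_{gcd(c,d)=1} (cz+d)^{-k}`. The exponent `k / 2` is
division of natural numbers, which is exact for the even weights `k`. -/
noncomputable def frickeEisenstein {k : ℕ} (hk : 3 ≤ k) (z : ℍ) : ℂ :=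
  ((2 : ℂ) ^ (k / 2) * ModularForm.E hk (doublePoint z) + ModularForm.E hk z) /
    ((2 : ℂ) ^ (k / 2) + 1)

/-- The fundamental domain of the Fricke group of level `2` in the upper half-plane. -/
def frickeDomain : Set ℍ :=
  {z | 1 / √2 ≤ ‖(z : ℂ)‖ ∧ -1 / 2 ≤ z.re ∧ z.re ≤ 0} ∪
    {z | 1 / √2 < ‖(z : ℂ)‖ ∧ 0 ≤ z.re ∧ z.re < 1 / 2}

/-- The closed arc `|z| = 1/√2`, `π/2 ≤ arg z ≤ 3π/4`. -/
def frickeArc : Set ℂ :=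
  {z | ‖z‖ = 1 / √2 ∧ Real.pi / 2 ≤ z.arg ∧ z.arg ≤ 3 * Real.pi / 4}

open scoped ModularForm

open UpperHalfPlane hiding I
open Complex Filter Topology Function Asymptotics MatrixGroups

/-! Write `x = (η(z) / η(2z)) ^ 24` and let `t = x + 4096 / x` be the Hauptmodul. On the circle `|z|
= 1 / √2` the Fricke involution is the reflection in the imaginary axis, and `x` has real
`q`-coefficients, so `|x| = 64` there. Since `64 / x` tends to `0` at the cusp, the maximum
principle gives `|x| > 64` at the points of the strip `|Re z| ≤ 1 / 2` above the circle
(`lt_norm_etaQuotient`). Conversely, a real value of `t` in `[-128, 128]` forces `|x| = 64`. So it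
suffices that `t` takes a value in `[-128, 128]` at every zero.

A form of weight `8m` with value `1` at the cusp, divided by the `m`-th power of the nowhere
vanishing cusp form `(η(z) η(2z)) ^ 8`, is a nonzero polynomial of degree at most `m` in `t`. This
rests on the constancy of bounded invariant functions, which a norm over cosets reduces to level
one. Along the arc the argument of `x` rises strictly from `0` to `π`, so `t = 128 cos (arg x)` is
injective there. Hence `m` distinct zeros on the arc already account for all roots of the
polynomial, and all of them lie in `[-128, 128]`. Multiplicities never have to be counted.

Zeros on the arc come from the method of Rankin and Swinnerton-Dyer. For `k = 2n`, multiplying the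
series by `e ^ (inθ)` makes it real, and an estimate of the Eisenstein series by three of its terms
gives alternating signs at the angles `jπ / n`. When `8` does not divide the weight, the series is
multiplied by `E*_4`, `E*_6` or both to reach a multiple of `8`; zeros forced at the ends of the arc
complete the count (`norm_etaQuotient_eq_of_frickeEisensteinFun_eq_zero`). -/

/-! ### Bounded functions invariant under the Fricke group -/

/-- A holomorphic function on the upper half-plane invariant under the generators `z ↦ z + 1` and
`z ↦ -1 / (2z)` of the Fricke group of level `2`. -/
structure IsFrickeInvariant (h : ℂ → ℂ) : Prop where
  differentiableOn : DifferentiableOn ℂ h upperHalfPlaneSet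
  map_add_one : ∀ z : ℂ, 0 < z.im → h (z + 1) = h z
  map_involution : ∀ z : ℂ, 0 < z.im → h (-1 / (2 * z)) = h z

lemma im_neg_one_div_two_mul_pos {z : ℂ} (hz : 0 < z.im) : 0 < (-1 / (2 * z)).im := by
  have hz0 : z ≠ 0 := by rintro rfl; simp at hz
  have := normSq_pos.mpr hz0
  rw [show -1 / (2 * z) = -(2 * z)⁻¹ by ring, neg_im, inv_im]
  simp only [map_mul, mul_im, re_ofNat, im_ofNat, zero_mul, add_zero]
  rw [neg_div, neg_neg]
  have : normSq 2 = 4 := by simp; norm_num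
  rw [this]
  positivity

lemma im_neg_one_div_pos {z : ℂ} (hz : 0 < z.im) : 0 < (-1 / z).im := by
  have := im_neg_one_div_two_mul_pos (z := z / 2) (by simpa using hz)
  rwa [mul_div_cancel₀ _ two_ne_zero] at this

lemma isPreconnected_upperHalfPlaneSet : IsPreconnected upperHalfPlaneSet :=
  (convex_halfSpace_im_gt 0).isPreconnected

lemma analyticOnNhd_upperHalfPlaneSet {f : ℂ → ℂ} (hf : DifferentiableOn ℂ f upperHalfPlaneSet) :
    AnalyticOnNhd ℂ f upperHalfPlaneSet :=
  hf.analyticOnNhd isOpen_upperHalfPlaneSet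

lemma differentiableOn_comp_of_im_pos {h g : ℂ → ℂ} (hh : DifferentiableOn ℂ h upperHalfPlaneSet)
    (hg : DifferentiableOn ℂ g upperHalfPlaneSet) (him : ∀ z : ℂ, 0 < z.im → 0 < (g z).im) :
    DifferentiableOn ℂ (fun z ↦ h (g z)) upperHalfPlaneSet :=
  hh.comp hg him

namespace IsFrickeInvariant

variable {h g : ℂ → ℂ}

lemma sub (hh : IsFrickeInvariant h) (hg : IsFrickeInvariant g) :
    IsFrickeInvariant (fun z ↦ h z - g z) where
  differentiableOn := hh.differentiableOn.sub hg.differentiableOn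
  map_add_one z hz := by rw [hh.map_add_one z hz, hg.map_add_one z hz]
  map_involution z hz := by rw [hh.map_involution z hz, hg.map_involution z hz]

lemma const_mul_pow (hh : IsFrickeInvariant h) (c : ℂ) (m : ℕ) :
    IsFrickeInvariant (fun z ↦ c * h z ^ m) where
  differentiableOn := (hh.differentiableOn.pow m).const_mul c
  map_add_one z hz := by rw [hh.map_add_one z hz]
  map_involution z hz := by rw [hh.map_involution z hz]

/-- The product over the three cosets of `Γ₀(2)` in `SL(2, ℤ)` of the translates of `h - c`. -/
noncomputable def normSubConst (h : ℂ → ℂ) (c : ℂ) (z : ℂ) : ℂ :=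
  (h z - c) * ((h (z / 2) - c) * (h ((z + 1) / 2) - c))

lemma normSubConst_add_one (hh : IsFrickeInvariant h) (c : ℂ) {z : ℂ} (hz : 0 < z.im) :
    normSubConst h c (z + 1) = normSubConst h c z := by
  have h1 : h ((z + 1 + 1) / 2) = h (z / 2) := by
    rw [show (z + 1 + 1) / 2 = z / 2 + 1 by ring, hh.map_add_one _ (by simpa using hz)]
  rw [normSubConst, normSubConst, hh.map_add_one z hz, h1]
  ring

/-- The inversion `z ↦ -1 / z` swaps the factors at `z` and `z / 2` through the Fricke involution,
and fixes the factor at `(z + 1) / 2` up to translations and two uses of the involution. -/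
lemma normSubConst_neg_one_div (hh : IsFrickeInvariant h) (c : ℂ) {z : ℂ} (hz : 0 < z.im) :
    normSubConst h c (-1 / z) = normSubConst h c z := by
  have hz0 : z ≠ 0 := by rintro rfl; simp at hz
  have hz1 : z - 1 ≠ 0 := by
    intro h0
    rw [sub_eq_zero] at h0
    simp [h0] at hz
  have h0 : h (-1 / z) = h (z / 2) := by
    rw [← hh.map_involution (z / 2) (by simpa using hz), mul_div_cancel₀ _ two_ne_zero]
  have h1 : h (-1 / z / 2) = h z := by
    rw [← hh.map_involution z hz]
    congr 1
    field_simp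
  have him : 0 < (-1 / (z - 1)).im := im_neg_one_div_pos (by simpa using hz)
  have h2 : h ((-1 / z + 1) / 2) = h ((z + 1) / 2) := by
    have e1 : (-1 / z + 1) / 2 = -1 / (2 * (-1 / (z - 1) - 1)) := by
      have : -1 / (z - 1) - 1 ≠ 0 := by
        rw [show -1 / (z - 1) - 1 = -z / (z - 1) by field_simp; ring]
        exact div_ne_zero (neg_ne_zero.mpr hz0) hz1
      rw [show -1 / (z - 1) - 1 = -z / (z - 1) by field_simp; ring]
      field_simp
      ring
    rw [e1, hh.map_involution _ (by simpa using him), ← hh.map_add_one _ (by simpa using him),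
      sub_add_cancel, show (z + 1) / 2 = (z - 1) / 2 + 1 by ring,
      hh.map_add_one _ (by simpa using hz), ← hh.map_involution ((z - 1) / 2) (by simpa using hz),
      mul_div_cancel₀ _ two_ne_zero]
  rw [normSubConst, normSubConst, h0, h1, h2]
  ring

lemma differentiableOn_normSubConst (hh : IsFrickeInvariant h) (c : ℂ) :
    DifferentiableOn ℂ (normSubConst h c) upperHalfPlaneSet := by
  refine (hh.differentiableOn.sub_const c).mul (DifferentiableOn.mul ?_ ?_)
  · exact (differentiableOn_comp_of_im_pos hh.differentiableOn (by fun_prop)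
      fun z hz ↦ by simpa using hz).sub_const c
  · exact (differentiableOn_comp_of_im_pos hh.differentiableOn (by fun_prop)
      fun z hz ↦ by simpa using hz).sub_const c

lemma isBoundedAtImInfty_normSubConst (c : ℂ)
    (hb : BoundedAtFilter (comap Complex.im atTop) h) :
    IsBoundedAtImInfty (fun τ : ℍ ↦ normSubConst h c τ) := by
  have hc : BoundedAtFilter (comap Complex.im atTop) (fun z ↦ h z - c) :=
    hb.sub (const_boundedAtFilter _ c)
  obtain ⟨M, hM⟩ := IsBigO.bound hc
  rw [eventually_comap] at hM
  obtain ⟨A, hA⟩ := eventually_atTop.mp hM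
  rw [isBoundedAtImInfty_iff]
  refine ⟨M * (M * M), max (2 * A) A, fun z hz ↦ ?_⟩
  have b (w : ℂ) (hw : A ≤ w.im) : ‖h w - c‖ ≤ M := by simpa using hA _ hw w rfl
  have b1 := b z (le_trans (le_max_right _ _) hz)
  have e := le_trans (le_max_left _ _) hz
  have b2 := b (z / 2) (by rw [div_ofNat_im]; simp; linarith)
  have b3 := b ((z + 1) / 2) (by rw [div_ofNat_im]; simp; linarith)
  have hM0 : 0 ≤ M := (norm_nonneg _).trans b1
  simp only [normSubConst, norm_mul]
  gcongr

/-- The level-one modular form of weight `0` with underlying function `normSubConst`. -/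
noncomputable def normSubConstForm (hh : IsFrickeInvariant h) (c : ℂ)
    (hb : BoundedAtFilter (comap Complex.im atTop) h) : ModularForm 𝒮ℒ 0 :=
  have hinv : ∀ γ : SL(2, ℤ), (fun τ : ℍ ↦ normSubConst h c τ) ∣[(0 : ℤ)] γ =
      fun τ : ℍ ↦ normSubConst h c τ := by
    refine SlashInvariantForm.slash_action_generators_SL2Z ?_ ?_
    · ext z
      rw [SlashInvariantForm.slash_S_apply]
      simp only [neg_zero, zpow_zero, mul_one]
      rw [← hh.normSubConst_neg_one_div c z.im_pos]
      congr 1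
      simp [neg_div, inv_neg]
    · ext z
      rw [ModularForm.SL_slash_apply, modular_T_smul]
      simp only [neg_zero, zpow_zero, mul_one]
      rw [← hh.normSubConst_add_one c z.im_pos]
      congr 1
      simp [add_comm]
  { toFun := fun τ ↦ normSubConst h c τ
    slash_action_eq' := by
      rintro A ⟨A, rfl⟩
      exact hinv A
    holo' := by
      rw [UpperHalfPlane.mdifferentiable_iff]
      refine (hh.differentiableOn_normSubConst c).congr fun z hz ↦ ?_
      simp [ofComplex_apply_of_im_pos hz]
    bdd_at_cusps' := by
      intro x hc
      rw [Subgroup.IsArithmetic.isCusp_iff_isCusp_SL2Z] at hc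
      rw [OnePoint.isBoundedAt_iff_forall_SL2Z hc]
      intro γ _
      rw [hinv]
      exact isBoundedAtImInfty_normSubConst c hb }

/-- A Fricke-invariant holomorphic function which is bounded at `i∞` is constant. -/
theorem exists_eq_const (hh : IsFrickeInvariant h)
    (hb : BoundedAtFilter (comap Complex.im atTop) h) :
    ∃ c, ∀ z : ℂ, 0 < z.im → h z = c := by
  refine ⟨h I, ?_⟩
  set c := h I with hc
  obtain ⟨b, hb'⟩ := ModularFormClass.levelOne_weight_zero_const (hh.normSubConstForm c hb)
  have hN (z : ℂ) (hz : 0 < z.im) : normSubConst h c z = b := congrFun hb' ⟨z, hz⟩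
  -- With `c` a value of `h`, the constant norm vanishes at `I`, hence everywhere. By the identity
  -- theorem one of its three factors vanishes identically, and each alternative says that `h` is
  -- constantly `c`.
  have hb0 : b = 0 := by
    rw [← hN I (by simp), normSubConst, hc, sub_self, zero_mul]
  have a1 := analyticOnNhd_upperHalfPlaneSet (hh.differentiableOn.sub_const c)
  have d2 : DifferentiableOn ℂ (fun z ↦ h (z / 2) - c) upperHalfPlaneSet :=
    (differentiableOn_comp_of_im_pos hh.differentiableOn (by fun_prop)
      fun z hz ↦ by simpa using hz).sub_const c
  have d3 : DifferentiableOn ℂ (fun z ↦ h ((z + 1) / 2) - c) upperHalfPlaneSet :=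
    (differentiableOn_comp_of_im_pos hh.differentiableOn (by fun_prop)
      fun z hz ↦ by simpa using hz).sub_const c
  have a2 := analyticOnNhd_upperHalfPlaneSet d2
  have a3 := analyticOnNhd_upperHalfPlaneSet d3
  have key := a1.eq_zero_or_eq_zero_of_mul_eq_zero (a2.mul a3)
    (fun z hz ↦ (hN z hz).trans hb0) isPreconnected_upperHalfPlaneSet
  rcases key with k1 | k
  · exact fun z hz ↦ sub_eq_zero.mp (k1 z hz)
  · rcases a2.eq_zero_or_eq_zero_of_mul_eq_zero a3 k isPreconnected_upperHalfPlaneSet with k | k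
    · intro z hz
      have := k (2 * z) (show 0 < (2 * z).im by simpa using hz)
      rwa [mul_div_cancel_left₀ _ two_ne_zero, sub_eq_zero] at this
    · intro z hz
      have := k (2 * z - 1) (show 0 < (2 * z - 1).im by simpa using hz)
      rwa [sub_add_cancel, mul_div_cancel_left₀ _ two_ne_zero, sub_eq_zero] at this

end IsFrickeInvariant

/-! ### Behaviour at the cusp and polynomials in a Hauptmodul -/

instance comap_im_atTop_neBot : (comap Complex.im atTop).NeBot :=
  NeBot.comap_of_surj inferInstance Complex.im_surjective

lemma eventually_comap_im_pos : ∀ᶠ z in comap Complex.im atTop, 0 < z.im :=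
  preimage_mem_comap (Ioi_mem_atTop 0)

/-- A holomorphic function on the upper half-plane which is `1`-periodic and bounded at `i∞` is a
constant up to an error `O(q)`. -/
lemma exists_sub_const_isBigO_qParam {g : ℂ → ℂ} (hg : DifferentiableOn ℂ g upperHalfPlaneSet)
    (hper : ∀ z : ℂ, 0 < z.im → g (z + 1) = g z)
    (hb : BoundedAtFilter (comap Complex.im atTop) g) :
    ∃ c : ℂ, (fun z ↦ g z - c) =O[comap Complex.im atTop] Periodic.qParam 1 := by
  -- Periodicity is only known on the upper half-plane; extension by zero makes it global without
  -- changing the germ at `i∞`.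
  let G : ℂ → ℂ := fun z ↦ if 0 < z.im then g z else 0
  have hGg : G =ᶠ[comap Complex.im atTop] g := by
    filter_upwards [eventually_comap_im_pos] with z hz
    simp [G, hz]
  have hGper : Periodic G ((1 : ℝ) : ℂ) := by
    intro z
    by_cases hz : 0 < z.im
    · simp [G, hz, hper z hz]
    · simp [G, hz]
  have hGd : ∀ᶠ z in comap Complex.im atTop, DifferentiableAt ℂ G z := by
    filter_upwards [eventually_comap_im_pos] with z hz
    have hnhds : upperHalfPlaneSet ∈ 𝓝 z := isOpen_upperHalfPlaneSet.mem_nhds hz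
    refine (hg.differentiableAt hnhds).congr_of_eventuallyEq ?_
    filter_upwards [hnhds] with w hw
    exact if_pos hw
  have hGb : BoundedAtFilter (comap Complex.im atTop) G := hb.congr' hGg.symm (by rfl)
  have := Periodic.exp_decay_sub_of_bounded_at_inf one_pos hGper hGd hGb
  refine ⟨Periodic.cuspFunction 1 G 0, ?_⟩
  refine IsBigO.of_norm_right ((this.congr' (hGg.sub (by rfl)) ?_))
  filter_upwards with z
  rw [Periodic.norm_qParam]

lemma tendsto_qParam_zero : Tendsto (Periodic.qParam 1) (comap Complex.im atTop) (𝓝 0) :=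
  (Periodic.qParam_tendsto one_pos).mono_right nhdsWithin_le_nhds

lemma qParam_add_one (z : ℂ) : Periodic.qParam 1 (z + 1) = Periodic.qParam 1 z := by
  simp only [Periodic.qParam, ofReal_one, div_one, mul_add, mul_one, exp_add, exp_two_pi_mul_I]

open Polynomial in
/-- If `t` is Fricke-invariant with a simple pole at the cusp, then every Fricke-invariant `h` with
a pole of order at most `m` at the cusp is a polynomial of degree at most `m` in `t`. -/
theorem IsFrickeInvariant.exists_polynomial {t : ℂ → ℂ} (ht : IsFrickeInvariant t)
    (ht1 : Tendsto (fun z ↦ Periodic.qParam 1 z * t z) (comap Complex.im atTop) (𝓝 1)) (m : ℕ) :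
    ∀ h : ℂ → ℂ, IsFrickeInvariant h →
      BoundedAtFilter (comap Complex.im atTop) (fun z ↦ Periodic.qParam 1 z ^ m * h z) →
      ∃ P : ℂ[X], P.natDegree ≤ m ∧ ∀ z : ℂ, 0 < z.im → h z = P.eval (t z) := by
  induction m with
  | zero =>
    intro h hh hb
    obtain ⟨c, hc⟩ := hh.exists_eq_const (by simpa using hb)
    exact ⟨C c, by simp, fun z hz ↦ by simp [hc z hz]⟩
  | succ m ih =>
    intro h hh hb
    have hq : DifferentiableOn ℂ (Periodic.qParam 1) upperHalfPlaneSet := by fun_prop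
    -- Here `c` is the coefficient of the pole of order `m + 1`; subtracting `c * t ^ (m + 1)`
    -- leaves a pole of order at most `m`, because both errors are `O(q)` and one factor `q` can be
    -- cancelled.
    obtain ⟨c, hc⟩ := exists_sub_const_isBigO_qParam
      (g := fun z ↦ Periodic.qParam 1 z ^ (m + 1) * h z)
      ((hq.pow _).mul hh.differentiableOn)
      (fun z hz ↦ by rw [qParam_add_one, hh.map_add_one z hz]) hb
    have htp : Tendsto (fun z ↦ Periodic.qParam 1 z ^ (m + 1) * t z ^ (m + 1))
        (comap Complex.im atTop) (𝓝 1) := by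
      simpa [mul_pow] using ht1.pow (m + 1)
    obtain ⟨d, hd⟩ := exists_sub_const_isBigO_qParam
      (g := fun z ↦ Periodic.qParam 1 z ^ (m + 1) * t z ^ (m + 1))
      ((hq.pow _).mul (ht.differentiableOn.pow _))
      (fun z hz ↦ by rw [qParam_add_one, ht.map_add_one z hz]) (htp.isBigO_one ℝ)
    have hd1 : d = 1 := by
      have h0 := hd.trans_tendsto tendsto_qParam_zero
      have h1 := (htp.sub_const d)
      exact (sub_eq_zero.mp (tendsto_nhds_unique h1 h0)).symm
    subst hd1
    have hsub : (fun z ↦ Periodic.qParam 1 z * (Periodic.qParam 1 z ^ m *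
        (h z - c * t z ^ (m + 1)))) =O[comap Complex.im atTop]
        (fun z ↦ Periodic.qParam 1 z * 1) := by
      refine (hc.sub (hd.const_mul_left c)).congr (fun z ↦ by ring) (fun z ↦ by ring)
    have hb' : BoundedAtFilter (comap Complex.im atTop)
        (fun z ↦ Periodic.qParam 1 z ^ m * (h z - c * t z ^ (m + 1))) := by
      obtain ⟨K, hK⟩ := hsub.bound
      refine IsBigO.of_bound K ?_
      filter_upwards [hK] with z hz
      rw [norm_mul, norm_mul _ (1 : ℂ), norm_one, mul_one, mul_comm K] at hz
      simpa using le_of_mul_le_mul_left hz (norm_pos_iff.mpr (Periodic.qParam_ne_zero z))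
    obtain ⟨P, hP, hPe⟩ := ih _ (hh.sub (ht.const_mul_pow c (m + 1))) hb'
    refine ⟨P + C c * X ^ (m + 1), ?_, fun z hz ↦ ?_⟩
    · exact (natDegree_add_le _ _).trans
        (max_le (hP.trans m.le_succ) (natDegree_C_mul_X_pow_le _ _))
    · simp [← hPe z hz]

/-! ### Eta quotients and the Hauptmodul -/

/-- The Euler product `∏ (1 - q ^ n)`. -/
noncomputable def eulerProduct (q : ℂ) : ℂ := ∏' n : ℕ, (1 - q ^ (n + 1))

lemma differentiableOn_eulerProduct : DifferentiableOn ℂ eulerProduct (Metric.ball 0 1) :=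
  ModularForm.differentiableOn_tprod_one_sub_pow

lemma eulerProduct_zero : eulerProduct 0 = 1 := by simp [eulerProduct]

lemma qParam_two_mul (z : ℂ) : Periodic.qParam 1 (2 * z) = Periodic.qParam 1 z ^ 2 := by
  simp only [Periodic.qParam, ← exp_nat_mul]
  congr 1
  push_cast
  ring

lemma eta_eq_qParam_mul_eulerProduct (z : ℂ) :
    ModularForm.eta z = Periodic.qParam 24 z * eulerProduct (Periodic.qParam 1 z) := rfl

lemma qParam_twentyFour_pow (z : ℂ) : Periodic.qParam 24 z ^ 24 = Periodic.qParam 1 z := by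
  simp only [Periodic.qParam, ← exp_nat_mul]
  congr 1
  push_cast
  ring

lemma qParam_twentyFour_pow_eight_mul (z : ℂ) :
    Periodic.qParam 24 z ^ 8 * Periodic.qParam 24 (2 * z) ^ 8 = Periodic.qParam 1 z := by
  simp only [Periodic.qParam, ← exp_nat_mul, ← exp_add]
  congr 1
  push_cast
  ring

lemma eulerProduct_conj (q : ℂ) :
    eulerProduct (starRingEnd ℂ q) = starRingEnd ℂ (eulerProduct q) := by
  unfold eulerProduct
  rw [Function.LeftInverse.map_tprod (g := starRingEnd ℂ) (g' := starRingEnd ℂ) _ continuous_conj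
    continuous_conj conj_conj]
  simp

lemma qParam_neg_conj (z : ℂ) :
    Periodic.qParam 1 (-starRingEnd ℂ z) = starRingEnd ℂ (Periodic.qParam 1 z) := by
  simp only [Periodic.qParam, ← exp_conj]
  simp [conj_ofNat]

lemma tendsto_eulerProduct_qParam :
    Tendsto (fun z ↦ eulerProduct (Periodic.qParam 1 z)) (comap Complex.im atTop) (𝓝 1) := by
  have h : ContinuousAt eulerProduct 0 :=
    (differentiableOn_eulerProduct.differentiableAt
      (Metric.ball_mem_nhds 0 one_pos)).continuousAt
  have h' := h.tendsto
  rw [eulerProduct_zero] at h'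
  exact h'.comp tendsto_qParam_zero

lemma tendsto_two_mul_comap_im :
    Tendsto (fun z : ℂ ↦ 2 * z) (comap Complex.im atTop) (comap Complex.im atTop) := by
  rw [tendsto_comap_iff]
  have : (Complex.im ∘ fun z : ℂ ↦ 2 * z) = fun z ↦ 2 * z.im := by ext z; simp
  rw [this]
  exact tendsto_comap.const_mul_atTop two_pos

lemma im_two_mul_pos {z : ℂ} (hz : 0 < z.im) : 0 < (2 * z).im := by simpa using hz

lemma differentiableOn_eta : DifferentiableOn ℂ ModularForm.eta upperHalfPlaneSet := fun _ hz ↦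
  (ModularForm.differentiableAt_eta_of_mem_upperHalfPlaneSet hz).differentiableWithinAt

lemma differentiableOn_eta_two_mul :
    DifferentiableOn ℂ (fun z ↦ ModularForm.eta (2 * z)) upperHalfPlaneSet :=
  differentiableOn_comp_of_im_pos differentiableOn_eta (by fun_prop) fun _ ↦ im_two_mul_pos

lemma sqrt_pow_eight {z : ℂ} (hz : z ≠ 0) : sqrt z ^ 8 = z ^ 4 := by
  rw [sqrt_eq_exp hz, ← exp_nat_mul]
  rw [show (8 : ℕ) * (log z / 2) = (4 : ℕ) * log z by push_cast; ring, exp_nat_mul, exp_log hz]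

lemma eta_neg_one_div_pow_eight {z : ℂ} (hz : 0 < z.im) :
    ModularForm.eta (-1 / z) ^ 8 = z ^ 4 * ModularForm.eta z ^ 8 := by
  have hz0 : z ≠ 0 := by rintro rfl; simp at hz
  have h : ModularForm.eta (-1 / z) = (sqrt I)⁻¹ * (sqrt z * ModularForm.eta z) := by
    simpa using ModularForm.eta_comp_eq_csqrt_I_inv (x := z) hz
  rw [h, mul_pow, mul_pow, inv_pow, sqrt_pow_eight I_ne_zero, sqrt_pow_eight hz0, I_pow_four]
  ring

/-- The cusp form `(η(z) η(2z)) ^ 8` of weight `8` for the Fricke group of level `2`. -/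
noncomputable def frickeCuspForm (z : ℂ) : ℂ :=
  ModularForm.eta z ^ 8 * ModularForm.eta (2 * z) ^ 8

/-- The eta quotient `(η(z) / η(2z)) ^ 24`. -/
noncomputable def etaQuotient (z : ℂ) : ℂ :=
  ModularForm.eta z ^ 24 / ModularForm.eta (2 * z) ^ 24

lemma frickeCuspForm_ne_zero {z : ℂ} (hz : 0 < z.im) : frickeCuspForm z ≠ 0 :=
  mul_ne_zero (pow_ne_zero _ (ModularForm.eta_ne_zero hz))
    (pow_ne_zero _ (ModularForm.eta_ne_zero (im_two_mul_pos hz)))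

lemma etaQuotient_ne_zero {z : ℂ} (hz : 0 < z.im) : etaQuotient z ≠ 0 :=
  div_ne_zero (pow_ne_zero _ (ModularForm.eta_ne_zero hz))
    (pow_ne_zero _ (ModularForm.eta_ne_zero (im_two_mul_pos hz)))

lemma differentiableOn_frickeCuspForm : DifferentiableOn ℂ frickeCuspForm upperHalfPlaneSet :=
  (differentiableOn_eta.pow 8).mul (differentiableOn_eta_two_mul.pow 8)

lemma differentiableOn_etaQuotient : DifferentiableOn ℂ etaQuotient upperHalfPlaneSet :=
  (differentiableOn_eta.pow 24).div (differentiableOn_eta_two_mul.pow 24) fun _ hz ↦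
    pow_ne_zero _ (ModularForm.eta_ne_zero (im_two_mul_pos hz))

lemma frickeCuspForm_eq (z : ℂ) : frickeCuspForm z = Periodic.qParam 1 z *
    (eulerProduct (Periodic.qParam 1 z) ^ 8 * eulerProduct (Periodic.qParam 1 z ^ 2) ^ 8) := by
  rw [frickeCuspForm, eta_eq_qParam_mul_eulerProduct, eta_eq_qParam_mul_eulerProduct,
    qParam_two_mul, mul_pow, mul_pow]
  linear_combination (eulerProduct (Periodic.qParam 1 z) ^ 8 *
    eulerProduct (Periodic.qParam 1 z ^ 2) ^ 8) * qParam_twentyFour_pow_eight_mul z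

lemma etaQuotient_eq (z : ℂ) : etaQuotient z = (Periodic.qParam 1 z)⁻¹ *
    (eulerProduct (Periodic.qParam 1 z) / eulerProduct (Periodic.qParam 1 z ^ 2)) ^ 24 := by
  rw [etaQuotient, eta_eq_qParam_mul_eulerProduct, eta_eq_qParam_mul_eulerProduct, mul_pow,
    mul_pow, qParam_twentyFour_pow, qParam_twentyFour_pow, qParam_two_mul]
  have := Periodic.qParam_ne_zero (h := 1) z
  rw [div_pow, mul_div_mul_comm]
  congr 1
  field_simp

lemma frickeCuspForm_add_one (z : ℂ) : frickeCuspForm (z + 1) = frickeCuspForm z := by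
  rw [frickeCuspForm_eq, frickeCuspForm_eq, qParam_add_one]

lemma etaQuotient_add_one (z : ℂ) : etaQuotient (z + 1) = etaQuotient z := by
  rw [etaQuotient_eq, etaQuotient_eq, qParam_add_one]

lemma etaQuotient_add_intCast (z : ℂ) (n : ℤ) : etaQuotient (z + n) = etaQuotient z := by
  have : Periodic etaQuotient (1 : ℂ) := etaQuotient_add_one
  simpa using this.int_mul n z

lemma etaQuotient_neg_conj (z : ℂ) :
    etaQuotient (-starRingEnd ℂ z) = starRingEnd ℂ (etaQuotient z) := by
  simp only [etaQuotient_eq, qParam_neg_conj, map_mul, map_inv₀, map_pow, map_div₀,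
    ← eulerProduct_conj]

lemma frickeCuspForm_involution {z : ℂ} (hz : 0 < z.im) :
    frickeCuspForm (-1 / (2 * z)) = 16 * z ^ 8 * frickeCuspForm z := by
  have hz0 : z ≠ 0 := by rintro rfl; simp at hz
  rw [frickeCuspForm, show 2 * (-1 / (2 * z)) = -1 / z by field_simp,
    eta_neg_one_div_pow_eight hz, eta_neg_one_div_pow_eight (im_two_mul_pos hz), frickeCuspForm]
  ring

lemma etaQuotient_involution {z : ℂ} (hz : 0 < z.im) :
    etaQuotient (-1 / (2 * z)) = 4096 / etaQuotient z := by
  have hz0 : z ≠ 0 := by rintro rfl; simp at hz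
  have h1 : ModularForm.eta (-1 / z) ^ 24 = z ^ 12 * ModularForm.eta z ^ 24 := by
    rw [show 24 = 8 * 3 from rfl, pow_mul, eta_neg_one_div_pow_eight hz]; ring
  have h2 : ModularForm.eta (-1 / (2 * z)) ^ 24 = (2 * z) ^ 12 * ModularForm.eta (2 * z) ^ 24 := by
    rw [show 24 = 8 * 3 from rfl, pow_mul, eta_neg_one_div_pow_eight (im_two_mul_pos hz)]; ring
  have h3 := ModularForm.eta_ne_zero hz
  have h4 := ModularForm.eta_ne_zero (im_two_mul_pos hz)
  rw [etaQuotient, show 2 * (-1 / (2 * z)) = -1 / z by field_simp, h1, h2, etaQuotient]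
  field_simp
  norm_num

lemma tendsto_eulerProduct_qParam_sq :
    Tendsto (fun z ↦ eulerProduct (Periodic.qParam 1 z ^ 2)) (comap Complex.im atTop) (𝓝 1) :=
  (tendsto_eulerProduct_qParam.comp tendsto_two_mul_comap_im).congr fun z ↦ by
    simp [qParam_two_mul]

lemma tendsto_frickeCuspForm_div_qParam :
    Tendsto (fun z ↦ frickeCuspForm z / Periodic.qParam 1 z) (comap Complex.im atTop) (𝓝 1) := by
  have := (tendsto_eulerProduct_qParam.pow 8).mul (tendsto_eulerProduct_qParam_sq.pow 8)
  simp only [one_pow, mul_one] at this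
  refine this.congr fun z ↦ ?_
  rw [frickeCuspForm_eq, mul_div_cancel_left₀ _ (Periodic.qParam_ne_zero z)]

lemma tendsto_qParam_mul_etaQuotient :
    Tendsto (fun z ↦ Periodic.qParam 1 z * etaQuotient z) (comap Complex.im atTop) (𝓝 1) := by
  have := (tendsto_eulerProduct_qParam.div tendsto_eulerProduct_qParam_sq one_ne_zero).pow 24
  simp only [one_pow, div_one] at this
  refine this.congr fun z ↦ ?_
  rw [etaQuotient_eq, mul_inv_cancel_left₀ (Periodic.qParam_ne_zero z)]
  rfl

/-- The Hauptmodul `x + 4096 / x`, with `x = (η(z) / η(2z)) ^ 24`, of the Fricke group of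
level `2`. -/
noncomputable def frickeHauptmodul (z : ℂ) : ℂ := etaQuotient z + 4096 / etaQuotient z

lemma isFrickeInvariant_frickeHauptmodul : IsFrickeInvariant frickeHauptmodul where
  differentiableOn := differentiableOn_etaQuotient.add
    ((differentiableOn_const _).div differentiableOn_etaQuotient fun _ hz ↦ etaQuotient_ne_zero hz)
  map_add_one z _ := by simp only [frickeHauptmodul, etaQuotient_add_one]
  map_involution z hz := by
    have := etaQuotient_ne_zero hz
    simp only [frickeHauptmodul, etaQuotient_involution hz]
    field_simp
    ring

lemma tendsto_qParam_mul_frickeHauptmodul :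
    Tendsto (fun z ↦ Periodic.qParam 1 z * frickeHauptmodul z) (comap Complex.im atTop)
      (𝓝 1) := by
  have h1 := tendsto_qParam_mul_etaQuotient
  have h2 : Tendsto (fun z ↦ Periodic.qParam 1 z ^ 2 * 4096 /
      (Periodic.qParam 1 z * etaQuotient z)) (comap Complex.im atTop) (𝓝 0) := by
    have := ((tendsto_qParam_zero.pow 2).mul_const 4096).div h1 one_ne_zero
    rwa [zero_pow two_ne_zero, zero_mul, zero_div] at this
  have h3 := h1.add h2
  rw [add_zero] at h3
  refine h3.congr fun z ↦ ?_
  have := Periodic.qParam_ne_zero (h := 1) z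
  rw [frickeHauptmodul, mul_add, sq, mul_assoc, mul_div_mul_left _ _ this]
  ring

lemma involution_eq_neg_conj {z : ℂ} (hz : normSq z = 1 / 2) :
    -1 / (2 * z) = -starRingEnd ℂ z := by
  have hz0 : z ≠ 0 := by rintro rfl; norm_num at hz
  have h : z * starRingEnd ℂ z = 1 / 2 := by rw [mul_conj, hz]; norm_num
  field_simp
  linear_combination 2 * h

/-- On this circle the involution is `z ↦ -conj z`, which conjugates the eta quotient `x`. The
functional equation becomes `conj x = 4096 / x`, that is `|x| ^ 2 = 64 ^ 2`. -/
lemma norm_etaQuotient_of_normSq_eq {z : ℂ} (him : 0 < z.im) (hz : normSq z = 1 / 2) :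
    ‖etaQuotient z‖ = 64 := by
  have h := etaQuotient_involution him
  rw [involution_eq_neg_conj hz, etaQuotient_neg_conj] at h
  have h1 := congrArg norm h
  rw [RCLike.norm_conj, norm_div] at h1
  have h0 := norm_pos_iff.mpr (etaQuotient_ne_zero him)
  rw [eq_div_iff h0.ne'] at h1
  norm_num at h1
  nlinarith

/-- The eta quotient takes no value infinitely often near a point of the upper half-plane. -/
lemma etaQuotient_not_frequently_eq {w : ℂ} (hw : 0 < w.im) (c : ℂ) :
    ¬ ∃ᶠ z in 𝓝[≠] w, etaQuotient z = c := by
  intro hf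
  have heq := AnalyticOnNhd.eqOn_of_preconnected_of_frequently_eq
    (analyticOnNhd_upperHalfPlaneSet differentiableOn_etaQuotient) (analyticOnNhd_const (v := c))
    isPreconnected_upperHalfPlaneSet hw hf
  have h1 : Tendsto (fun z ↦ Periodic.qParam 1 z * etaQuotient z) (comap Complex.im atTop)
      (𝓝 (0 * c)) := by
    refine (tendsto_qParam_zero.mul_const c).congr' ?_
    filter_upwards [eventually_comap_im_pos] with z hz
    rw [heq hz]
  have := tendsto_nhds_unique h1 tendsto_qParam_mul_etaQuotient
  simp at this

/-! ### The maximum principle on the fundamental domain -/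

/-- The union of the integer translates of the closed fundamental domain. -/
def frickeRegion : Set ℂ := {z | 0 < z.im ∧ ∀ n : ℤ, 1 / 2 ≤ normSq (z + n)}

lemma normSq_le_normSq_add_intCast {z : ℂ} (hz : |z.re| ≤ 1 / 2) (n : ℤ) :
    normSq z ≤ normSq (z + n) := by
  simp only [normSq_apply, add_re, intCast_re, add_im, intCast_im, add_zero]
  obtain ⟨h1, h2⟩ := abs_le.mp hz
  rcases lt_trichotomy n 0 with hn | rfl | hn
  · have : (n : ℝ) ≤ -1 := by exact_mod_cast Int.le_sub_one_of_lt hn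
    nlinarith
  · simp
  · have : (1 : ℝ) ≤ n := by exact_mod_cast hn
    nlinarith

lemma eventually_mem_frickeRegion {w : ℂ} (hw : 0 < w.im)
    (hn : ∀ n : ℤ, 1 / 2 < normSq (w + n)) : ∀ᶠ z in 𝓝 w, z ∈ frickeRegion := by
  have h1 : ∀ᶠ z in 𝓝 w, 0 < z.im := continuous_im.continuousAt.eventually (lt_mem_nhds hw)
  -- Only finitely many translates can come near the circle: for `n` outside this range and `z`
  -- within `1` of `w` horizontally, `|Re (z + n)| > 2`.
  have h2 : ∀ᶠ z in 𝓝 w, ∀ n ∈ Finset.Icc (⌊-w.re⌋ - 2) (⌊-w.re⌋ + 3),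
      1 / 2 < normSq (z + (n : ℤ)) := by
    rw [Filter.eventually_all_finset]
    intro n _
    exact (continuous_normSq.comp (continuous_id.add continuous_const)).continuousAt.eventually
      (lt_mem_nhds (hn n))
  have h3 : ∀ᶠ z in 𝓝 w, |z.re - w.re| < 1 := by
    have : ContinuousAt (fun z : ℂ ↦ |z.re - w.re|) w := by fun_prop
    exact this.eventually (gt_mem_nhds (by simp))
  filter_upwards [h1, h2, h3] with z hz1 hz2 hz3
  refine ⟨hz1, fun n ↦ ?_⟩
  by_cases hmem : n ∈ Finset.Icc (⌊-w.re⌋ - 2) (⌊-w.re⌋ + 3)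
  · exact (hz2 n hmem).le
  · rw [Finset.mem_Icc, not_and_or, not_le, not_le] at hmem
    obtain ⟨h4, h5⟩ := abs_lt.mp hz3
    have f1 := Int.floor_le (-w.re)
    have f2 := Int.lt_floor_add_one (-w.re)
    simp only [normSq_apply, add_re, intCast_re, add_im, intCast_im, add_zero]
    rcases hmem with h | h
    · have : (n : ℝ) ≤ ⌊-w.re⌋ - 3 := by
        have : n ≤ ⌊-w.re⌋ - 3 := by lia
        exact_mod_cast this
      nlinarith
    · have : (⌊-w.re⌋ : ℝ) + 4 ≤ n := by
        have : ⌊-w.re⌋ + 4 ≤ n := by lia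
        exact_mod_cast this
      nlinarith

/-- Such a point is interior to the region. Working with all integer translates makes the vertical
sides `Re z = ±1 / 2` interior too, so the maximum principle leaves only the circular boundary. -/
lemma not_isMaxOn_of_forall_lt_normSq {w : ℂ} (hw : 0 < w.im)
    (hn : ∀ n : ℤ, 1 / 2 < normSq (w + n)) :
    ¬ IsMaxOn (fun z ↦ ‖64 / etaQuotient z‖) frickeRegion w := by
  intro hmax
  have hnhds : upperHalfPlaneSet ∈ 𝓝 w := isOpen_upperHalfPlaneSet.mem_nhds hw
  have hd : ∀ᶠ z in 𝓝 w, DifferentiableAt ℂ (fun z ↦ 64 / etaQuotient z) z := by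
    filter_upwards [hnhds] with z hz
    exact (differentiableAt_const _).div
      (differentiableOn_etaQuotient.differentiableAt (isOpen_upperHalfPlaneSet.mem_nhds hz))
      (etaQuotient_ne_zero hz)
  have hloc : IsLocalMax (norm ∘ fun z ↦ 64 / etaQuotient z) w := by
    filter_upwards [eventually_mem_frickeRegion hw hn] with z hz
    exact hmax hz
  have hev := eventually_eq_of_isLocalMax_norm hd hloc
  refine etaQuotient_not_frequently_eq hw (etaQuotient w) (Eventually.frequently ?_)
  refine nhdsWithin_le_nhds ?_
  filter_upwards [hev, hnhds] with z hz hz'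
  have h1 := etaQuotient_ne_zero hz'
  have h2 := etaQuotient_ne_zero hw
  rw [div_eq_div_iff h1 h2] at hz
  exact (mul_left_cancel₀ (by norm_num) hz).symm

lemma tendsto_const_div_etaQuotient :
    Tendsto (fun z ↦ 64 / etaQuotient z) (comap Complex.im atTop) (𝓝 0) := by
  have h := (tendsto_qParam_zero.mul_const 64).div tendsto_qParam_mul_etaQuotient one_ne_zero
  rw [zero_mul, zero_div] at h
  refine h.congr fun z ↦ ?_
  simp only [Pi.div_apply]
  rw [mul_div_mul_left _ _ (Periodic.qParam_ne_zero z)]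

lemma exists_int_abs_re_add_le (z : ℂ) : ∃ n : ℤ, |(z + n).re| ≤ 1 / 2 := by
  refine ⟨-round z.re, ?_⟩
  have := abs_sub_round z.re
  simpa [sub_eq_add_neg] using this

lemma exists_isMaxOn_frickeRegion :
    ∃ w ∈ frickeRegion, IsMaxOn (fun z ↦ ‖64 / etaQuotient z‖) frickeRegion w := by
  have hev := tendsto_const_div_etaQuotient.eventually (Metric.ball_mem_nhds 0 one_pos)
  rw [eventually_comap] at hev
  obtain ⟨A, hA⟩ := eventually_atTop.mp hev
  set B := max A 1
  let K : Set ℂ := (Set.Icc (-(1 / 2)) (1 / 2) ×ℂ Set.Icc (1 / 2) B) ∩ {z | 1 / 2 ≤ normSq z}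
  have hKc : IsCompact K := (isCompact_Icc.reProdIm isCompact_Icc).inter_right
    (isClosed_le continuous_const continuous_normSq)
  have hKpos {z : ℂ} (hz : z ∈ K) : 0 < z.im := by
    have := hz.1.2.1
    linarith
  have hKR : K ⊆ frickeRegion := fun z hz ↦ ⟨hKpos hz, fun n ↦
    le_trans hz.2 (normSq_le_normSq_add_intCast (abs_le.mpr hz.1.1) n)⟩
  -- The point `i / √2` shows that the maximum over `K` is at least `1`, so it also dominates the
  -- part of the region above height `B`, where the function is below `1`.
  obtain ⟨p, hpK, hp⟩ : ∃ p ∈ K, ‖64 / etaQuotient p‖ = 1 := by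
    obtain ⟨s, hs0, hs⟩ : ∃ s : ℝ, 0 < s ∧ s ^ 2 = 1 / 2 :=
      ⟨√(1 / 2), by positivity, Real.sq_sqrt (by norm_num)⟩
    have hsN : normSq (s * I) = 1 / 2 := by simp [normSq_apply, ← sq, hs]
    refine ⟨s * I, ⟨⟨by norm_num, ?_, ?_⟩, hsN.ge⟩, ?_⟩
    · simp only [mul_im, ofReal_re, Complex.I_im, mul_one, ofReal_im, zero_mul, add_zero]
      nlinarith
    · simp only [mul_im, ofReal_re, Complex.I_im, mul_one, ofReal_im, zero_mul, add_zero]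
      refine le_trans ?_ (le_max_right A 1)
      nlinarith
    · rw [norm_div, norm_etaQuotient_of_normSq_eq (by simpa using hs0) hsN]
      norm_num
  have hcont : ContinuousOn (fun z ↦ ‖64 / etaQuotient z‖) K := by
    refine ContinuousOn.norm (continuousOn_const.div
      (differentiableOn_etaQuotient.continuousOn.mono fun z hz ↦ hKpos hz)
      fun z hz ↦ etaQuotient_ne_zero (hKpos hz))
  obtain ⟨w, hwK, hw⟩ := hKc.exists_isMaxOn ⟨p, hpK⟩ hcont
  refine ⟨w, hKR hwK, fun z hz ↦ ?_⟩
  have hw1 : 1 ≤ ‖64 / etaQuotient w‖ := hp ▸ hw hpK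
  obtain ⟨n, hn⟩ := exists_int_abs_re_add_le z
  simp only [Set.mem_ofPred_eq]
  rw [← etaQuotient_add_intCast z n]
  have him : (z + n).im = z.im := by simp
  by_cases hB : (z + n).im ≤ B
  · refine hw ⟨⟨abs_le.mp hn, ?_, hB⟩, hz.2 n⟩
    have h1 := hz.2 n
    have h2 : ((z + n).re) ^ 2 ≤ (1 / 2) ^ 2 := sq_le_sq' (abs_le.mp hn).1 (abs_le.mp hn).2
    have h3 : 0 < (z + n).im := him ▸ hz.1
    rw [normSq_apply] at h1
    nlinarith
  · refine le_trans ?_ hw1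
    have := hA (z + n).im ((le_max_left A 1).trans (not_le.mp hB).le) _ rfl
    exact (mem_ball_zero_iff.mp this).le

lemma norm_const_div_etaQuotient_le_one {z : ℂ} (hz : z ∈ frickeRegion) :
    ‖64 / etaQuotient z‖ ≤ 1 := by
  obtain ⟨w, hwR, hw⟩ := exists_isMaxOn_frickeRegion
  refine (hw hz).trans (le_of_eq ?_)
  by_cases hlt : ∀ n : ℤ, 1 / 2 < normSq (w + n)
  · exact absurd hw (not_isMaxOn_of_forall_lt_normSq hwR.1 hlt)
  · push Not at hlt
    obtain ⟨n, hn⟩ := hlt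
    beta_reduce
    rw [norm_div, ← etaQuotient_add_intCast w n, norm_etaQuotient_of_normSq_eq
      (by simpa using hwR.1) (le_antisymm hn (hwR.2 n))]
    norm_num

/-- On the closed fundamental domain `64 ≤ |η(z) / η(2z)| ^ 24`. -/
lemma le_norm_etaQuotient {z : ℂ} (him : 0 < z.im) (hre : |z.re| ≤ 1 / 2)
    (hz : 1 / 2 ≤ normSq z) : 64 ≤ ‖etaQuotient z‖ := by
  have h := norm_const_div_etaQuotient_le_one (z := z)
    ⟨him, fun n ↦ hz.trans (normSq_le_normSq_add_intCast hre n)⟩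
  rw [norm_div, div_le_one (norm_pos_iff.mpr (etaQuotient_ne_zero him))] at h
  simpa using h

/-- Above the arc `|η(z) / η(2z)| ^ 24` is larger than `64`. -/
lemma lt_norm_etaQuotient {z : ℂ} (him : 0 < z.im) (hre : |z.re| ≤ 1 / 2)
    (hz : 1 / 2 < normSq z) : 64 < ‖etaQuotient z‖ := by
  refine (le_norm_etaQuotient him hre hz.le).lt_of_ne fun h ↦ ?_
  refine not_isMaxOn_of_forall_lt_normSq him
    (fun n ↦ hz.trans_le (normSq_le_normSq_add_intCast hre n)) fun w hw ↦ ?_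
  refine (norm_const_div_etaQuotient_le_one hw).trans (le_of_eq ?_)
  beta_reduce
  rw [norm_div, ← h]
  norm_num

/-- A point where the Hauptmodul takes a value in `[-128, 128]` has `|η(z) / η(2z)| ^ 24 = 64`. -/
lemma norm_etaQuotient_eq_of_frickeHauptmodul_eq {z : ℂ} (him : 0 < z.im) {s : ℝ}
    (hs : |s| ≤ 128) (ht : frickeHauptmodul z = s) : ‖etaQuotient z‖ = 64 := by
  have hx := etaQuotient_ne_zero him
  set x := etaQuotient z with hxdef
  -- The value `x` is a root of `X ^ 2 - s X + 4096`, whose discriminant is nonpositive for `|s| ≤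
  -- 128`. Its roots are therefore conjugate with product `64 ^ 2`.
  have hq : (x - s / 2) ^ 2 = -(4096 - (s / 2) ^ 2) := by
    rw [frickeHauptmodul, ← hxdef] at ht
    field_simp at ht
    linear_combination ht
  have hs2 : (s / 2) ^ 2 ≤ 4096 := by
    have := abs_le.mp hs
    nlinarith
  have hre := congrArg Complex.re hq
  have him' := congrArg Complex.im hq
  simp only [sq, mul_re, mul_im, sub_re, sub_im, neg_re, neg_im] at hre him'
  norm_num at hre him'
  have : normSq x = 4096 := by
    rw [normSq_apply]
    rcases (by
      have : (x.re - s / 2) * x.im = 0 := by linarith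
      exact mul_eq_zero.mp this : x.re - s / 2 = 0 ∨ x.im = 0) with h | h
    · have : x.re = s / 2 := by linarith
      rw [this] at hre ⊢
      nlinarith
    · rw [h] at hre ⊢
      have h5 : (x.re - s / 2) ^ 2 = 0 := le_antisymm (by nlinarith) (sq_nonneg _)
      have h6 : x.re = s / 2 := by
        have := pow_eq_zero_iff (two_ne_zero) |>.mp h5
        linarith
      rw [h6] at hre ⊢
      nlinarith
  rw [normSq_eq_norm_sq] at this
  nlinarith [norm_nonneg x]

/-! ### The argument of the eta quotient along the arc -/

/-- The logarithm `∑ log (1 - q ^ n)` of the Euler product. -/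
noncomputable def logEulerProduct (q : ℂ) : ℂ := ∑' n : ℕ, log (1 - q ^ (n + 1))

lemma norm_log_one_sub_pow_le {q : ℂ} (hq : ‖q‖ ≤ 1 / 2) (n : ℕ) :
    ‖log (1 - q ^ (n + 1))‖ ≤ 3 / 2 * (1 / 2) ^ (n + 1) := by
  have h1 : ‖-q ^ (n + 1)‖ ≤ (1 / 2) ^ (n + 1) := by
    rw [norm_neg, norm_pow]
    exact pow_le_pow_left₀ (norm_nonneg _) hq _
  have h2 : ((1 : ℝ) / 2) ^ (n + 1) ≤ 1 / 2 := by
    simpa using pow_le_pow_of_le_one (by norm_num : (0 : ℝ) ≤ 1 / 2) (by norm_num)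
      (Nat.le_add_left 1 n)
  have := norm_log_one_add_half_le_self (h1.trans h2)
  rw [sub_eq_add_neg]
  linarith

lemma summable_geometric_bound : Summable fun n : ℕ ↦ (3 : ℝ) / 2 * (1 / 2) ^ (n + 1) :=
  ((summable_nat_add_iff 1).mpr summable_geometric_two).mul_left _

lemma one_sub_mem_slitPlane {w : ℂ} (hw : ‖w‖ < 1) : 1 - w ∈ slitPlane := by
  refine Or.inl ?_
  have := (abs_le.mp (abs_re_le_norm w)).2
  simp
  linarith

lemma differentiableOn_logEulerProduct :
    DifferentiableOn ℂ logEulerProduct (Metric.ball 0 (1 / 2)) := by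
  refine differentiableOn_tsum_of_summable_norm summable_geometric_bound (fun n ↦ ?_)
    Metric.isOpen_ball fun n q hq ↦ norm_log_one_sub_pow_le (mem_ball_zero_iff.mp hq).le n
  refine DifferentiableOn.clog (by fun_prop) fun q hq ↦ one_sub_mem_slitPlane ?_
  rw [norm_pow]
  exact pow_lt_one₀ (norm_nonneg _) ((mem_ball_zero_iff.mp hq).trans (by norm_num)) (by lia)

lemma exp_logEulerProduct {q : ℂ} (hq : ‖q‖ < 1 / 2) :
    exp (logEulerProduct q) = eulerProduct q := by
  refine cexp_tsum_eq_tprod (fun n ↦ slitPlane_ne_zero (one_sub_mem_slitPlane ?_)) ?_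
  · rw [norm_pow]
    exact pow_lt_one₀ (norm_nonneg _) (hq.trans (by norm_num)) (by lia)
  · exact Summable.of_norm_bounded summable_geometric_bound (norm_log_one_sub_pow_le hq.le)

lemma logEulerProduct_ofReal_im {q : ℝ} (hq : |q| < 1 / 2) : (logEulerProduct q).im = 0 := by
  have hs : Summable fun n : ℕ ↦ log (1 - (q : ℂ) ^ (n + 1)) :=
    Summable.of_norm_bounded summable_geometric_bound
      (norm_log_one_sub_pow_le (by simpa using hq.le))
  rw [logEulerProduct, im_tsum hs]
  refine (tsum_congr fun n ↦ ?_).trans tsum_zero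
  have h1 : |q ^ (n + 1)| < 1 := by
    rw [abs_pow]
    exact pow_lt_one₀ (abs_nonneg _) (hq.trans (by norm_num)) (by lia)
  have h2 : 0 ≤ 1 - q ^ (n + 1) := by linarith [(abs_lt.mp h1).2]
  rw [show (1 : ℂ) - (q : ℂ) ^ (n + 1) = ((1 - q ^ (n + 1) : ℝ) : ℂ) by push_cast; ring,
    ← ofReal_log h2, ofReal_im]

lemma norm_qParam_lt_half {z : ℂ} (hz : 1 / 4 < z.im) : ‖Periodic.qParam 1 z‖ < 1 / 2 := by
  rw [Periodic.norm_qParam, div_one]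
  have h1 : -2 * Real.pi * z.im < -1 := by nlinarith [Real.pi_gt_three]
  have h2 : Real.exp (-1) < 1 / 2 := by
    rw [Real.exp_neg, inv_eq_one_div]
    exact one_div_lt_one_div_of_lt two_pos (by linarith [Real.exp_one_gt_d9])
  exact (Real.exp_lt_exp.mpr h1).trans h2

lemma norm_qParam_sq_lt_half {z : ℂ} (hz : 1 / 4 < z.im) :
    ‖Periodic.qParam 1 z ^ 2‖ < 1 / 2 := by
  rw [← qParam_two_mul]
  exact norm_qParam_lt_half (by simp; linarith)

/-- A logarithm of the eta quotient on the half-plane `1 / 4 < Im z`. -/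
noncomputable def logEtaQuotient (z : ℂ) : ℂ :=
  -(2 * Real.pi * I * z) +
    24 * (logEulerProduct (Periodic.qParam 1 z) - logEulerProduct (Periodic.qParam 1 z ^ 2))

lemma exp_logEtaQuotient {z : ℂ} (hz : 1 / 4 < z.im) :
    exp (logEtaQuotient z) = etaQuotient z := by
  rw [logEtaQuotient, exp_add, show (24 : ℂ) = (24 : ℕ) by norm_num, exp_nat_mul, exp_sub,
    exp_logEulerProduct (norm_qParam_lt_half hz), exp_logEulerProduct (norm_qParam_sq_lt_half hz),
    etaQuotient_eq, exp_neg]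
  simp [Periodic.qParam]

lemma differentiableAt_logEtaQuotient {z : ℂ} (hz : 1 / 4 < z.im) :
    DifferentiableAt ℂ logEtaQuotient z := by
  have h1 : DifferentiableAt ℂ (fun z ↦ logEulerProduct (Periodic.qParam 1 z)) z :=
    (differentiableOn_logEulerProduct.differentiableAt (Metric.isOpen_ball.mem_nhds
      (mem_ball_zero_iff.mpr (norm_qParam_lt_half hz)))).comp z (by fun_prop)
  have h2 : DifferentiableAt ℂ (fun z ↦ logEulerProduct (Periodic.qParam 1 z ^ 2)) z :=
    (differentiableOn_logEulerProduct.differentiableAt (Metric.isOpen_ball.mem_nhds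
      (mem_ball_zero_iff.mpr (norm_qParam_sq_lt_half hz)))).comp
        (f := fun z ↦ Periodic.qParam 1 z ^ 2) z (by fun_prop)
  unfold logEtaQuotient
  fun_prop

/-- The point of argument `θ` on the circle `|z| = 1 / √2`. -/
noncomputable def arcPoint (θ : ℝ) : ℂ := exp (θ * I) / (√2 : ℝ)

lemma arcPoint_re (θ : ℝ) : (arcPoint θ).re = Real.cos θ / √2 := by
  rw [arcPoint, div_ofReal_re, exp_ofReal_mul_I_re]

lemma arcPoint_im (θ : ℝ) : (arcPoint θ).im = Real.sin θ / √2 := by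
  rw [arcPoint, div_ofReal_im, exp_ofReal_mul_I_im]

lemma normSq_arcPoint (θ : ℝ) : normSq (arcPoint θ) = 1 / 2 := by
  rw [normSq_apply, arcPoint_re, arcPoint_im]
  have h := Real.sin_sq_add_cos_sq θ
  have h2 : √2 * √2 = (2 : ℝ) := Real.mul_self_sqrt zero_le_two
  rw [div_mul_div_comm, div_mul_div_comm, h2]
  linarith

lemma hasDerivAt_arcPoint (θ : ℝ) : HasDerivAt arcPoint (I * arcPoint θ) θ := by
  have h : HasDerivAt (fun θ : ℝ ↦ exp (θ * I)) (exp (θ * I) * (1 * I)) θ :=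
    (((hasDerivAt_id (θ : ℂ)).mul_const I).cexp).comp_ofReal
  convert! h.div_const ((√2 : ℝ) : ℂ) using 1
  rw [arcPoint]
  ring

lemma continuous_arcPoint : Continuous arcPoint :=
  continuous_iff_continuousAt.mpr fun θ ↦ (hasDerivAt_arcPoint θ).continuousAt

lemma cos_three_pi_div_four : Real.cos (3 * Real.pi / 4) = -(√2 / 2) := by
  rw [show 3 * Real.pi / 4 = Real.pi - Real.pi / 4 by ring, Real.cos_pi_sub, Real.cos_pi_div_four]

lemma sin_three_pi_div_four : Real.sin (3 * Real.pi / 4) = √2 / 2 := by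
  rw [show 3 * Real.pi / 4 = Real.pi - Real.pi / 4 by ring, Real.sin_pi_sub, Real.sin_pi_div_four]

lemma arcPoint_im_ge {θ : ℝ} (hθ : θ ∈ Set.Icc (Real.pi / 2) (3 * Real.pi / 4)) :
    1 / 2 ≤ (arcPoint θ).im := by
  have h1 : Real.sin (3 * Real.pi / 4) ≤ Real.sin θ := by
    rw [← Real.sin_pi_sub, ← Real.sin_pi_sub θ]
    exact Real.sin_le_sin_of_le_of_le_pi_div_two (by linarith [hθ.2, Real.pi_pos])
      (by linarith [hθ.1]) (by linarith [hθ.2])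
  rw [sin_three_pi_div_four] at h1
  rw [arcPoint_im, le_div_iff₀ (by positivity)]
  linarith

lemma arcPoint_im_pos {θ : ℝ} (hθ : θ ∈ Set.Icc (Real.pi / 2) (3 * Real.pi / 4)) :
    0 < (arcPoint θ).im :=
  one_half_pos.trans_le (arcPoint_im_ge hθ)

lemma arcPoint_re_mem {θ : ℝ} (hθ : θ ∈ Set.Ioo (Real.pi / 2) (3 * Real.pi / 4)) :
    (arcPoint θ).re ∈ Set.Ioo (-(1 / 2)) (1 / 2) := by
  have h1 : Real.cos (3 * Real.pi / 4) < Real.cos θ :=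
    Real.cos_lt_cos_of_nonneg_of_le_pi (by linarith [hθ.1, Real.pi_pos])
      (by linarith [Real.pi_pos]) hθ.2
  have h2 : Real.cos θ < 0 :=
    Real.cos_neg_of_pi_div_two_lt_of_lt hθ.1 (by linarith [hθ.2, Real.pi_pos])
  rw [cos_three_pi_div_four] at h1
  have h3 : (0 : ℝ) < √2 := by positivity
  rw [arcPoint_re]
  constructor
  · rw [lt_div_iff₀ h3]; linarith
  · have : Real.cos θ / √2 < 0 := div_neg_of_neg_of_pos h2 h3
    linarith

lemma exp_logEtaQuotient_re {z : ℂ} (hz : 1 / 4 < z.im) :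
    Real.exp (logEtaQuotient z).re = ‖etaQuotient z‖ := by
  rw [← exp_logEtaQuotient hz, norm_exp]

/-- The continuous argument of the eta quotient along the arc. -/
noncomputable def etaQuotientArg (θ : ℝ) : ℝ := (logEtaQuotient (arcPoint θ)).im

lemma hasDerivAt_etaQuotientArg {θ : ℝ} (hθ : θ ∈ Set.Icc (Real.pi / 2) (3 * Real.pi / 4)) :
    HasDerivAt etaQuotientArg (deriv logEtaQuotient (arcPoint θ) * arcPoint θ).re θ := by
  have hz : 1 / 4 < (arcPoint θ).im := by linarith [arcPoint_im_ge hθ]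
  have h1 : HasDerivAt (fun θ ↦ logEtaQuotient (arcPoint θ))
      (deriv logEtaQuotient (arcPoint θ) * (I * arcPoint θ)) θ :=
    (differentiableAt_logEtaQuotient hz).hasDerivAt.comp_of_eq θ (hasDerivAt_arcPoint θ) rfl
  have h2 := imCLM.hasFDerivAt.comp_hasDerivAt θ h1
  convert! h2 using 1
  rw [imCLM_apply, mul_left_comm, I_mul_im]

/-- This real part is both the derivative of the argument along the arc and the radial derivative of
`log |x|`, by the Cauchy–Riemann equations. The latter is nonnegative because `|x|` equals `64` on
the arc and is at least `64` just outside it. -/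
lemma deriv_logEtaQuotient_mul_re_nonneg {θ : ℝ}
    (hθ : θ ∈ Set.Ioo (Real.pi / 2) (3 * Real.pi / 4)) :
    0 ≤ (deriv logEtaQuotient (arcPoint θ) * arcPoint θ).re := by
  have hθ' := Set.Ioo_subset_Icc_self hθ
  set z := arcPoint θ with hzdef
  have hz : 1 / 4 < z.im := by linarith [arcPoint_im_ge hθ']
  have hexp : HasDerivAt (fun s : ℝ ↦ exp (s : ℂ) * z) z 0 := by
    have h : HasDerivAt (fun s : ℝ ↦ exp (s : ℂ)) (exp ((0 : ℝ) : ℂ) * 1) 0 :=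
      ((hasDerivAt_id ((0 : ℝ) : ℂ)).cexp).comp_ofReal
    simpa using h.mul_const z
  have h1 : HasDerivAt (fun s : ℝ ↦ logEtaQuotient (exp (s : ℂ) * z))
      (deriv logEtaQuotient z * z) 0 :=
    (differentiableAt_logEtaQuotient hz).hasDerivAt.comp_of_eq 0 hexp (by simp)
  have h2 : HasDerivAt (fun s : ℝ ↦ (logEtaQuotient (exp (s : ℂ) * z)).re)
      (deriv logEtaQuotient z * z).re 0 :=
    reCLM.hasFDerivAt.comp_hasDerivAt 0 h1
  refine ge_of_tendsto h2.tendsto_slope_zero_right ?_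
  have hc := hexp.continuousAt
  have e1 : ∀ᶠ s : ℝ in 𝓝 0, 1 / 4 < (exp (s : ℂ) * z).im :=
    (continuous_im.continuousAt.comp hc).eventually (lt_mem_nhds (by simpa using hz))
  -- Away from the ends of the arc a short radial segment stays in the strip where the lower bound
  -- for `|x|` is available.
  have e2 : ∀ᶠ s : ℝ in 𝓝 0, (exp (s : ℂ) * z).re ∈ Set.Ioo (-(1 / 2)) (1 / 2) :=
    (continuous_re.continuousAt.comp hc).eventually
      (isOpen_Ioo.mem_nhds (by simpa using arcPoint_re_mem hθ))
  filter_upwards [nhdsWithin_le_nhds e1, nhdsWithin_le_nhds e2, self_mem_nhdsWithin]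
    with s hs1 hs2 hs3
  have hs3' : (0 : ℝ) < s := hs3
  have hN : 1 / 2 ≤ normSq (exp (s : ℂ) * z) := by
    rw [normSq_mul, normSq_arcPoint, normSq_eq_norm_sq, norm_exp, ofReal_re]
    have := Real.one_le_exp hs3'.le
    nlinarith
  have hle := le_norm_etaQuotient (by linarith) (abs_le.mpr ⟨hs2.1.le, hs2.2.le⟩) hN
  rw [← norm_etaQuotient_of_normSq_eq (by linarith) (normSq_arcPoint θ), ← hzdef,
    ← exp_logEtaQuotient_re hz, ← exp_logEtaQuotient_re hs1, Real.exp_le_exp] at hle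
  simp only [zero_add, ofReal_zero, exp_zero, one_mul, smul_eq_mul]
  exact mul_nonneg (inv_nonneg.mpr hs3'.le) (sub_nonneg.mpr hle)

lemma monotoneOn_etaQuotientArg :
    MonotoneOn etaQuotientArg (Set.Icc (Real.pi / 2) (3 * Real.pi / 4)) := by
  refine monotoneOn_of_deriv_nonneg (convex_Icc _ _)
    (fun θ hθ ↦ (hasDerivAt_etaQuotientArg hθ).continuousAt.continuousWithinAt)
    (fun θ hθ ↦
      (hasDerivAt_etaQuotientArg (interior_subset hθ)).differentiableAt.differentiableWithinAt)
    fun θ hθ ↦ ?_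
  rw [interior_Icc] at hθ
  rw [(hasDerivAt_etaQuotientArg (Set.Ioo_subset_Icc_self hθ)).deriv]
  exact deriv_logEtaQuotient_mul_re_nonneg hθ

lemma etaQuotient_arcPoint {θ : ℝ} (hθ : θ ∈ Set.Icc (Real.pi / 2) (3 * Real.pi / 4)) :
    etaQuotient (arcPoint θ) = 64 * exp (etaQuotientArg θ * I) := by
  have hz : 1 / 4 < (arcPoint θ).im := by linarith [arcPoint_im_ge hθ]
  have h1 := exp_logEtaQuotient_re hz
  rw [norm_etaQuotient_of_normSq_eq (by linarith) (normSq_arcPoint θ)] at h1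
  rw [← exp_logEtaQuotient hz, ← re_add_im (logEtaQuotient (arcPoint θ)), exp_add, ← ofReal_exp,
    h1, etaQuotientArg]
  norm_num

lemma arcPoint_injOn : Set.InjOn arcPoint (Set.Icc (Real.pi / 2) (3 * Real.pi / 4)) := by
  intro a ha b hb hab
  have h := congrArg Complex.re hab
  rw [arcPoint_re, arcPoint_re, div_left_inj' (by positivity)] at h
  exact Real.injOn_cos ⟨by linarith [ha.1, Real.pi_pos], by linarith [ha.2, Real.pi_pos]⟩
    ⟨by linarith [hb.1, Real.pi_pos], by linarith [hb.2, Real.pi_pos]⟩ h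

/-- Equal values at two points would make the argument, and so the eta quotient, constant on the arc
between them, against the identity theorem. -/
lemma strictMonoOn_etaQuotientArg :
    StrictMonoOn etaQuotientArg (Set.Icc (Real.pi / 2) (3 * Real.pi / 4)) := by
  intro a ha b hb hab
  refine (monotoneOn_etaQuotientArg ha hb hab.le).lt_of_ne fun heq ↦ ?_
  refine etaQuotient_not_frequently_eq (arcPoint_im_pos ha) (etaQuotient (arcPoint a)) ?_
  have ht : Tendsto arcPoint (𝓝[>] a) (𝓝[≠] (arcPoint a)) := by
    refine tendsto_nhdsWithin_iff.mpr
      ⟨continuous_arcPoint.continuousAt.tendsto.mono_left nhdsWithin_le_nhds, ?_⟩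
    filter_upwards [Ioo_mem_nhdsGT hab] with θ hθ h
    exact hθ.1.ne' (arcPoint_injOn ⟨ha.1.trans hθ.1.le, hθ.2.le.trans hb.2⟩ ha h)
  refine ht.frequently (Eventually.frequently ?_)
  filter_upwards [Ioo_mem_nhdsGT hab] with θ hθ
  have hθ' : θ ∈ Set.Icc (Real.pi / 2) (3 * Real.pi / 4) :=
    ⟨ha.1.trans hθ.1.le, hθ.2.le.trans hb.2⟩
  have : etaQuotientArg θ = etaQuotientArg a := le_antisymm
    ((monotoneOn_etaQuotientArg hθ' hb hθ.2.le).trans heq.ge)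
    (monotoneOn_etaQuotientArg ha hθ' hθ.1.le)
  rw [etaQuotient_arcPoint hθ', etaQuotient_arcPoint ha, this]

/-- For real `q` the logarithms of the Euler products are real, so only the linear term contributes.
This applies at both ends of the arc, where `Re z` is `0` and `-1 / 2`. -/
lemma logEtaQuotient_im_of_qParam_eq {z : ℂ} (hz : 1 / 4 < z.im) {r : ℝ}
    (hr : Periodic.qParam 1 z = r) : (logEtaQuotient z).im = -(2 * Real.pi * z.re) := by
  have h1 := norm_qParam_lt_half hz
  have h2 := norm_qParam_sq_lt_half hz
  rw [logEtaQuotient, hr]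
  rw [hr, norm_real, Real.norm_eq_abs] at h1
  rw [hr, ← ofReal_pow, norm_real, Real.norm_eq_abs] at h2
  have e1 := logEulerProduct_ofReal_im h1
  have e2 := logEulerProduct_ofReal_im h2
  rw [ofReal_pow] at e2
  simp [e1, e2]

lemma etaQuotientArg_pi_div_two : etaQuotientArg (Real.pi / 2) = 0 := by
  have hm : Real.pi / 2 ∈ Set.Icc (Real.pi / 2) (3 * Real.pi / 4) :=
    ⟨le_rfl, by linarith [Real.pi_pos]⟩
  have hz : 1 / 4 < (arcPoint (Real.pi / 2)).im := by linarith [arcPoint_im_ge hm]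
  have hre : (arcPoint (Real.pi / 2)).re = 0 := by rw [arcPoint_re]; simp
  have hr : Periodic.qParam 1 (arcPoint (Real.pi / 2)) =
      (Real.exp (-(2 * Real.pi * (arcPoint (Real.pi / 2)).im)) : ℝ) := by
    rw [Periodic.qParam, ofReal_exp]
    congr 1
    conv_lhs => rw [← re_add_im (arcPoint (Real.pi / 2)), hre]
    push_cast
    linear_combination (2 * Real.pi * (arcPoint (Real.pi / 2)).im : ℂ) * I_sq
  rw [etaQuotientArg, logEtaQuotient_im_of_qParam_eq hz hr, hre]
  simp

lemma etaQuotientArg_three_pi_div_four : etaQuotientArg (3 * Real.pi / 4) = Real.pi := by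
  have hm : 3 * Real.pi / 4 ∈ Set.Icc (Real.pi / 2) (3 * Real.pi / 4) :=
    ⟨by linarith [Real.pi_pos], le_rfl⟩
  have hz : 1 / 4 < (arcPoint (3 * Real.pi / 4)).im := by linarith [arcPoint_im_ge hm]
  have hre : (arcPoint (3 * Real.pi / 4)).re = -(1 / 2) := by
    rw [arcPoint_re, cos_three_pi_div_four]
    field_simp
  have hr : Periodic.qParam 1 (arcPoint (3 * Real.pi / 4)) =
      (-Real.exp (-(2 * Real.pi * (arcPoint (3 * Real.pi / 4)).im)) : ℝ) := by
    rw [Periodic.qParam, ofReal_neg, ofReal_exp, neg_eq_neg_one_mul, ← exp_neg_pi_mul_I, ← exp_add]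
    congr 1
    conv_lhs => rw [← re_add_im (arcPoint (3 * Real.pi / 4)), hre]
    push_cast
    linear_combination (2 * Real.pi * (arcPoint (3 * Real.pi / 4)).im : ℂ) * I_sq
  rw [etaQuotientArg, logEtaQuotient_im_of_qParam_eq hz hr, hre]
  ring

/-- On the arc the Hauptmodul is real, strictly decreasing, with values in `[-128, 128]`. -/
theorem exists_strictAntiOn_frickeHauptmodul :
    ∃ τ : ℝ → ℝ, StrictAntiOn τ (Set.Icc (Real.pi / 2) (3 * Real.pi / 4)) ∧
      (∀ θ, |τ θ| ≤ 128) ∧ ∀ θ ∈ Set.Icc (Real.pi / 2) (3 * Real.pi / 4),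
        frickeHauptmodul (arcPoint θ) = τ θ := by
  have hl : Real.pi / 2 ∈ Set.Icc (Real.pi / 2) (3 * Real.pi / 4) :=
    ⟨le_rfl, by linarith [Real.pi_pos]⟩
  have hr : 3 * Real.pi / 4 ∈ Set.Icc (Real.pi / 2) (3 * Real.pi / 4) :=
    ⟨by linarith [Real.pi_pos], le_rfl⟩
  refine ⟨fun θ ↦ 128 * Real.cos (etaQuotientArg θ), fun a ha b hb hab ↦ ?_, fun θ ↦ ?_,
    fun θ hθ ↦ ?_⟩
  · have h0 := monotoneOn_etaQuotientArg hl ha ha.1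
    have h1 := monotoneOn_etaQuotientArg hb hr hb.2
    rw [etaQuotientArg_pi_div_two] at h0
    rw [etaQuotientArg_three_pi_div_four] at h1
    have := Real.cos_lt_cos_of_nonneg_of_le_pi h0 h1 (strictMonoOn_etaQuotientArg ha hb hab)
    linarith
  · rw [abs_mul]
    have := Real.abs_cos_le_one (etaQuotientArg θ)
    norm_num
    linarith
  · rw [frickeHauptmodul, etaQuotient_arcPoint hθ, ofReal_mul, ofReal_cos, Complex.cos,
      neg_mul, exp_neg]
    have := exp_ne_zero (etaQuotientArg θ * I)
    push_cast
    field_simp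
    ring

/-! ### Fricke forms, their polynomials in the Hauptmodul, and forced zeros -/

/-- A holomorphic form of weight `2h` for the Fricke group of level `2`, with sign `+1` under the
involution, normalized to have the value `1` at the cusp. -/
structure IsFrickeForm (h : ℕ) (g : ℂ → ℂ) : Prop where
  differentiableOn : DifferentiableOn ℂ g upperHalfPlaneSet
  map_add_one : ∀ z : ℂ, 0 < z.im → g (z + 1) = g z
  map_involution : ∀ z : ℂ, 0 < z.im → g (-1 / (2 * z)) = (2 * z ^ 2) ^ h * g z
  tendsto_one : Tendsto g (comap Complex.im atTop) (𝓝 1)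

namespace IsFrickeForm

variable {h h' m : ℕ} {g g' : ℂ → ℂ}

lemma mul (hg : IsFrickeForm h g) (hg' : IsFrickeForm h' g') :
    IsFrickeForm (h + h') (fun z ↦ g z * g' z) where
  differentiableOn := hg.differentiableOn.mul hg'.differentiableOn
  map_add_one z hz := by rw [hg.map_add_one z hz, hg'.map_add_one z hz]
  map_involution z hz := by
    rw [hg.map_involution z hz, hg'.map_involution z hz]
    ring
  tendsto_one := by simpa using hg.tendsto_one.mul hg'.tendsto_one

lemma isFrickeInvariant_div (hg : IsFrickeForm (4 * m) g) :
    IsFrickeInvariant (fun z ↦ g z / frickeCuspForm z ^ m) where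
  differentiableOn := hg.differentiableOn.div (differentiableOn_frickeCuspForm.pow m)
    fun _ hz ↦ pow_ne_zero _ (frickeCuspForm_ne_zero hz)
  map_add_one z hz := by rw [hg.map_add_one z hz, frickeCuspForm_add_one]
  map_involution z hz := by
    have hz0 : z ≠ 0 := by rintro rfl; simp at hz
    rw [hg.map_involution z hz, frickeCuspForm_involution hz, mul_pow _ (frickeCuspForm z),
      show (2 * z ^ 2) ^ (4 * m) = (16 * z ^ 8) ^ m by rw [pow_mul]; ring]
    exact mul_div_mul_left _ _
      (pow_ne_zero _ (mul_ne_zero (by norm_num) (pow_ne_zero _ hz0)))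

lemma tendsto_qParam_pow_mul_div (hg : IsFrickeForm h g) :
    Tendsto (fun z ↦ Periodic.qParam 1 z ^ m * (g z / frickeCuspForm z ^ m))
      (comap Complex.im atTop) (𝓝 1) := by
  have := hg.tendsto_one.div (tendsto_frickeCuspForm_div_qParam.pow m) (by simp)
  rw [one_pow, div_one] at this
  refine this.congr fun z ↦ ?_
  have := pow_ne_zero m (Periodic.qParam_ne_zero (h := 1) z)
  simp only [Pi.div_apply, div_pow]
  rw [div_div_eq_mul_div]
  ring

open Polynomial in
/-- If a form of weight `8m` vanishes at `m` distinct points of the arc, then all its zeros `w`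
satisfy `|η(w) / η(2w)| ^ 24 = 64`. -/
theorem norm_etaQuotient_eq_of_eq_zero (hg : IsFrickeForm (4 * m) g) (S : Finset ℝ)
    (hS : ∀ θ ∈ S, θ ∈ Set.Icc (Real.pi / 2) (3 * Real.pi / 4)) (hcard : m ≤ S.card)
    (hzero : ∀ θ ∈ S, g (arcPoint θ) = 0) {w : ℂ} (hw : 0 < w.im) (hgw : g w = 0) :
    ‖etaQuotient w‖ = 64 := by
  obtain ⟨P, hdeg, hP⟩ := isFrickeInvariant_frickeHauptmodul.exists_polynomial
    tendsto_qParam_mul_frickeHauptmodul m _ hg.isFrickeInvariant_div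
    (hg.tendsto_qParam_pow_mul_div.isBigO_one ℝ)
  obtain ⟨τ, hanti, hτ, hτt⟩ := exists_strictAntiOn_frickeHauptmodul
  have hP0 : P ≠ 0 := by
    rintro rfl
    have h1 := hg.tendsto_qParam_pow_mul_div (m := m)
    have h2 : Tendsto (fun z ↦ Periodic.qParam 1 z ^ m * (g z / frickeCuspForm z ^ m))
        (comap Complex.im atTop) (𝓝 0) := by
      refine tendsto_const_nhds.congr' ?_
      filter_upwards [eventually_comap_im_pos] with z hz
      rw [hP z hz]
      simp
    exact one_ne_zero (tendsto_nhds_unique h1 h2)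
  let T : Finset ℂ := S.image fun θ ↦ (τ θ : ℂ)
  have hTcard : T.card = S.card := Finset.card_image_of_injOn fun a ha b hb hab ↦
    hanti.injOn (hS a ha) (hS b hb) (ofReal_injective hab)
  have hTroot : ∀ s ∈ T, P.eval s = 0 := by
    intro s hs
    obtain ⟨θ, hθ, rfl⟩ := Finset.mem_image.mp hs
    rw [← hτt θ (hS θ hθ), ← hP _ (arcPoint_im_pos (hS θ hθ)), hzero θ hθ, zero_div]
  have hwroot : P.eval (frickeHauptmodul w) = 0 := by
    rw [← hP w hw, hgw, zero_div]
  -- A further root would give `P` at least `m + 1` roots, more than its degree allows.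
  have hmem : frickeHauptmodul w ∈ T := by
    by_contra hnot
    refine hP0 (Polynomial.eq_zero_of_natDegree_lt_card_of_eval_eq_zero' P
      (insert (frickeHauptmodul w) T) (fun s hs ↦ ?_) ?_)
    · rcases Finset.mem_insert.mp hs with rfl | hs
      · exact hwroot
      · exact hTroot s hs
    · rw [Finset.card_insert_of_notMem hnot, hTcard]
      lia
  obtain ⟨θ, _, hθ⟩ := Finset.mem_image.mp hmem
  exact norm_etaQuotient_eq_of_frickeHauptmodul_eq hw (hτ θ) hθ.symm

/-- At an elliptic point the transformation law reads `g z = ε * g z`, with `ε` the automorphy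
factor. -/
lemma eq_zero_of_involution_eq (hg : IsFrickeForm h g) {z : ℂ} (hz : 0 < z.im)
    (hfix : g (-1 / (2 * z)) = g z) (hne : (2 * z ^ 2) ^ h ≠ 1) : g z = 0 := by
  have h1 := hg.map_involution z hz
  rw [hfix] at h1
  have : ((2 * z ^ 2) ^ h - 1) * g z = 0 := by linear_combination -h1
  exact (mul_eq_zero.mp this).resolve_left (sub_ne_zero.mpr hne)

lemma two_mul_arcPoint_sq (θ : ℝ) : 2 * arcPoint θ ^ 2 = exp (2 * θ * I) := by
  have h2 : ((√2 : ℝ) : ℂ) ^ 2 = 2 := by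
    rw [← ofReal_pow, Real.sq_sqrt zero_le_two]; norm_num
  rw [arcPoint, div_pow, h2, ← exp_nat_mul]
  push_cast
  field_simp

/-- Forms of weight `2h` with `h` odd vanish at `i / √2`. -/
lemma eq_zero_at_pi_div_two (hg : IsFrickeForm h g) (hh : Odd h) :
    g (arcPoint (Real.pi / 2)) = 0 := by
  have hm : Real.pi / 2 ∈ Set.Icc (Real.pi / 2) (3 * Real.pi / 4) :=
    ⟨le_rfl, by linarith [Real.pi_pos]⟩
  refine hg.eq_zero_of_involution_eq (arcPoint_im_pos hm) ?_ ?_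
  · congr 1
    rw [involution_eq_neg_conj (normSq_arcPoint _)]
    apply Complex.ext <;> simp [arcPoint_re]
  · rw [two_mul_arcPoint_sq]
    have : exp (2 * ((Real.pi / 2 : ℝ) : ℂ) * I) = -1 := by
      rw [← exp_pi_mul_I]; congr 1; push_cast; ring
    rw [this, hh.neg_one_pow]
    norm_num

/-- Forms of weight `2h` with `4 ∤ h` vanish at `(-1 + i) / 2`. -/
lemma eq_zero_at_three_pi_div_four (hg : IsFrickeForm h g) (hh : ¬ 4 ∣ h) :
    g (arcPoint (3 * Real.pi / 4)) = 0 := by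
  have hm : 3 * Real.pi / 4 ∈ Set.Icc (Real.pi / 2) (3 * Real.pi / 4) :=
    ⟨by linarith [Real.pi_pos], le_rfl⟩
  refine hg.eq_zero_of_involution_eq (arcPoint_im_pos hm) ?_ ?_
  -- The involution sends `(-1 + i) / 2` to `(1 + i) / 2`, its translate by `1`.
  · rw [← hg.map_add_one _ (arcPoint_im_pos hm)]
    congr 1
    rw [involution_eq_neg_conj (normSq_arcPoint _)]
    apply Complex.ext
    · simp only [neg_re, conj_re, add_re, one_re, arcPoint_re, cos_three_pi_div_four]
      field_simp
      norm_num
    · simp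
  · rw [two_mul_arcPoint_sq]
    have : exp (2 * ((3 * Real.pi / 4 : ℝ) : ℂ) * I) = -I := by
      rw [show (2 * ((3 * Real.pi / 4 : ℝ) : ℂ) * I) = Real.pi * I + Real.pi / 2 * I by
        push_cast; ring, exp_add, exp_pi_mul_I, exp_pi_div_two_mul_I]
      ring
    rw [this]
    intro h1
    apply hh
    have hI : orderOf (-I) = 4 := by
      have : Fact (Nat.Prime 2) := ⟨Nat.prime_two⟩
      exact orderOf_eq_prime_pow (p := 2) (n := 1) (by norm_num) (by norm_num [neg_pow, I_pow_four])
    exact hI ▸ orderOf_dvd_of_pow_eq_one h1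

end IsFrickeForm

/-! ### Eisenstein series as Fricke forms -/

/-- The Eisenstein series of level one as a function on `ℂ`. -/
noncomputable def eisensteinFun {k : ℕ} (hk : 3 ≤ k) (z : ℂ) : ℂ := ModularForm.E hk (ofComplex z)

section eisensteinFun

variable {k : ℕ} (hk : 3 ≤ k)

lemma differentiableOn_eisensteinFun : DifferentiableOn ℂ (eisensteinFun hk) upperHalfPlaneSet :=
  UpperHalfPlane.mdifferentiable_iff.mp (ModularForm.E hk).holo'

lemma eisensteinFun_apply_of_im_pos {z : ℂ} (hz : 0 < z.im) :
    eisensteinFun hk z = ModularForm.E hk ⟨z, hz⟩ := by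
  rw [eisensteinFun, ofComplex_apply_of_im_pos hz]

lemma periodic_E_comp_ofComplex : Periodic (ModularForm.E hk ∘ ofComplex) ((1 : ℝ) : ℂ) :=
  SlashInvariantFormClass.periodic_comp_ofComplex (ModularForm.E hk) one_mem_strictPeriods_SL

lemma eisensteinFun_add_one (z : ℂ) : eisensteinFun hk (z + 1) = eisensteinFun hk z := by
  simpa [eisensteinFun] using periodic_E_comp_ofComplex hk z

lemma eisensteinFun_neg_one_div {z : ℂ} (hz : 0 < z.im) :
    eisensteinFun hk (-1 / z) = z ^ k * eisensteinFun hk z := by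
  have hz0 : z ≠ 0 := by rintro rfl; simp at hz
  have h := congrFun ((ModularForm.E hk).slash_action_eq' _ ⟨ModularGroup.S, rfl⟩) ⟨z, hz⟩
  change ((ModularForm.E hk : ℍ → ℂ) ∣[(k : ℤ)] ModularGroup.S) ⟨z, hz⟩ = _ at h
  rw [SlashInvariantForm.slash_S_apply] at h
  rw [eisensteinFun_apply_of_im_pos hk hz, eisensteinFun_apply_of_im_pos hk (im_neg_one_div_pos hz)]
  change _ = (ModularForm.E hk) ⟨z, hz⟩ at h
  rw [← h, mul_comm (z ^ k), mul_assoc]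
  simp only [zpow_neg, zpow_natCast]
  rw [inv_mul_cancel₀ (pow_ne_zero _ hz0), mul_one]
  congr 1
  ext
  simp [neg_div, inv_neg]

lemma tendsto_eisensteinFun (hk2 : Even k) :
    Tendsto (eisensteinFun hk) (comap Complex.im atTop) (𝓝 1) := by
  have hbdd : IsBoundedAtImInfty (ModularForm.E hk) :=
    ModularFormClass.bdd_at_infty (ModularForm.E hk)
  have hdec := exp_decay_sub_atImInfty one_pos (periodic_E_comp_ofComplex hk)
    (ModularForm.E hk).holo' hbdd
  have hv : valueAtInfty (ModularForm.E hk) = 1 := by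
    rw [← EisensteinSeries.E_qExpansion_coeff_zero hk hk2,
      UpperHalfPlane.qExpansion_coeff_zero one_pos (analyticAt_cuspFunction_zero one_pos
        (periodic_E_comp_ofComplex hk) (ModularForm.E hk).holo' hbdd)
        (periodic_E_comp_ofComplex hk)]
  rw [hv] at hdec
  have h0 : Tendsto (fun τ : ℍ ↦ Real.exp (-2 * Real.pi * τ.im / 1)) atImInfty (𝓝 0) := by
    have : Tendsto (fun τ : ℍ ↦ -2 * Real.pi * τ.im / 1) atImInfty atBot := by
      simp only [div_one]
      exact tendsto_comap.const_mul_atTop_of_neg (by linarith [Real.pi_pos])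
    exact Real.tendsto_exp_atBot.comp this
  have h1 := (hdec.trans_tendsto h0).add_const 1
  simp only [sub_add_cancel, zero_add] at h1
  exact h1.comp tendsto_comap_im_ofComplex

/-- The Eisenstein series for the Fricke group of level `2` as a function on `ℂ`. -/
noncomputable def frickeEisensteinFun (z : ℂ) : ℂ :=
  ((2 : ℂ) ^ (k / 2) * eisensteinFun hk (2 * z) + eisensteinFun hk z) / ((2 : ℂ) ^ (k / 2) + 1)

lemma frickeEisenstein_eq (z : ℍ) : frickeEisenstein hk z = frickeEisensteinFun hk z := by
  rw [frickeEisenstein, frickeEisensteinFun, eisensteinFun_apply_of_im_pos hk z.im_pos,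
    eisensteinFun_apply_of_im_pos hk (im_two_mul_pos z.im_pos)]
  rfl

lemma two_pow_add_one_ne_zero (n : ℕ) : (2 : ℂ) ^ n + 1 ≠ 0 := by
  exact_mod_cast (Nat.succ_ne_zero (2 ^ n))

lemma isFrickeForm_frickeEisensteinFun (hk2 : Even k) :
    IsFrickeForm (k / 2) (frickeEisensteinFun hk) where
  differentiableOn := (((differentiableOn_comp_of_im_pos (differentiableOn_eisensteinFun hk)
    (by fun_prop) fun _ ↦ im_two_mul_pos).const_mul _).add
      (differentiableOn_eisensteinFun hk)).div_const _
  map_add_one z _ := by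
    rw [frickeEisensteinFun, show 2 * (z + 1) = 2 * z + 1 + 1 by ring, eisensteinFun_add_one,
      eisensteinFun_add_one, eisensteinFun_add_one, frickeEisensteinFun]
  map_involution z hz := by
    have hz0 : z ≠ 0 := by rintro rfl; simp at hz
    obtain ⟨h, rfl⟩ := hk2
    have hh : (h + h) / 2 = h := by lia
    rw [frickeEisensteinFun, show 2 * (-1 / (2 * z)) = -1 / z by field_simp,
      eisensteinFun_neg_one_div hk hz, eisensteinFun_neg_one_div hk (im_two_mul_pos hz),
      frickeEisensteinFun, hh]
    ring
  tendsto_one := by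
    have h1 := tendsto_eisensteinFun hk hk2
    have h2 := (((h1.comp tendsto_two_mul_comap_im).const_mul ((2 : ℂ) ^ (k / 2))).add
      h1).div_const ((2 : ℂ) ^ (k / 2) + 1)
    rw [mul_one, div_self (two_pow_add_one_ne_zero _)] at h2
    exact h2

end eisensteinFun

/-! ### Three-term approximation of the Eisenstein series on the arc -/

open scoped Classical in
/-- The summand `(cz + d) ^ (-k)` of the Eisenstein series, extended by zero to pairs which are not
coprime. -/
noncomputable def coprimeSummand (k : ℕ) (z : ℂ) (p : ℤ × ℤ) : ℂ :=
  if IsCoprime p.1 p.2 then ((p.1 * z + p.2) ^ k)⁻¹ else 0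

lemma hasSum_coprimeSummand {k : ℕ} (hk : 3 ≤ k) {z : ℂ} (hz : 0 < z.im) :
    HasSum (coprimeSummand k z) (2 * eisensteinFun hk z) := by
  have h1 : 2 * eisensteinFun hk z =
      ∑' v : EisensteinSeries.gammaSet 1 1 0, EisensteinSeries.eisSummand k v ⟨z, hz⟩ := by
    rw [eisensteinFun_apply_of_im_pos hk hz]
    change 2 * ((1 / 2 : ℂ) * _) = _
    rw [← mul_assoc, show (2 : ℂ) * (1 / 2) = 1 by norm_num, one_mul]
    rfl
  have h2 : Summable fun v : EisensteinSeries.gammaSet 1 1 0 ↦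
      EisensteinSeries.eisSummand k v ⟨z, hz⟩ :=
    (summable_eisSummand hk ⟨z, hz⟩).subtype _
  rw [h1, ← (finTwoArrowEquiv ℤ).hasSum_iff]
  have h3 := (hasSum_subtype_iff_indicator (s := EisensteinSeries.gammaSet 1 1 0)
    (f := fun v ↦ EisensteinSeries.eisSummand k v ⟨z, hz⟩)).mp h2.hasSum
  convert h3 using 1
  ext v
  simp only [comp_apply, finTwoArrowEquiv_apply, coprimeSummand, Set.indicator,
    EisensteinSeries.mem_gammaSet_one, EisensteinSeries.eisSummand, zpow_neg, zpow_natCast]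
  rfl

/-- Conjugating the series term by term amounts to the substitution `c ↦ -c` on coprime pairs, as
`k` is a natural number and `d` is an integer. -/
lemma eisensteinFun_neg_conj {k : ℕ} (hk : 3 ≤ k) {z : ℂ} (hz : 0 < z.im) :
    eisensteinFun hk (-starRingEnd ℂ z) = starRingEnd ℂ (eisensteinFun hk z) := by
  have h1 := (hasSum_coprimeSummand hk hz).map (starRingEnd ℂ) continuous_conj
  have h2 := hasSum_coprimeSummand hk (z := -starRingEnd ℂ z) (by simpa using hz)
  rw [← ((Equiv.neg ℤ).prodCongr (Equiv.refl ℤ)).hasSum_iff] at h2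
  have h3 : coprimeSummand k (-starRingEnd ℂ z) ∘ ((Equiv.neg ℤ).prodCongr (Equiv.refl ℤ)) =
      starRingEnd ℂ ∘ coprimeSummand k z := by
    ext p
    simp only [comp_apply, coprimeSummand, Equiv.prodCongr_apply, Prod.map, Equiv.neg_apply,
      Equiv.refl_apply, IsCoprime.neg_left_iff]
    split_ifs <;> simp
  rw [h3] at h2
  have h4 := h2.unique h1
  rw [map_mul, conj_ofNat] at h4
  exact mul_left_cancel₀ two_ne_zero h4

/-- Twice the square norm of `cz + d` on the arc. -/
lemma two_mul_normSq_arcPoint (θ : ℝ) (c d : ℤ) :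
    2 * normSq (c * arcPoint θ + d) =
      c ^ 2 + 2 * d ^ 2 + 4 * (c * d) * (arcPoint θ).re := by
  have h := normSq_arcPoint θ
  rw [normSq_apply] at h ⊢
  simp only [add_re, mul_re, intCast_re, intCast_im, zero_mul, sub_zero, add_im, mul_im, add_zero]
  linear_combination (2 * (c : ℝ) ^ 2) * h

lemma arcPoint_re_mem_Icc {θ : ℝ} (hθ : θ ∈ Set.Icc (Real.pi / 2) (3 * Real.pi / 4)) :
    (arcPoint θ).re ∈ Set.Icc (-(1 / 2)) 0 := by
  have h1 : Real.cos (3 * Real.pi / 4) ≤ Real.cos θ :=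
    Real.cos_le_cos_of_nonneg_of_le_pi (by linarith [hθ.1, Real.pi_pos])
      (by linarith [Real.pi_pos]) hθ.2
  have h2 : Real.cos θ ≤ 0 :=
    Real.cos_nonpos_of_pi_div_two_le_of_le hθ.1 (by linarith [hθ.2, Real.pi_pos])
  rw [cos_three_pi_div_four] at h1
  have h3 : (0 : ℝ) < √2 := by positivity
  rw [arcPoint_re]
  exact ⟨by rw [le_div_iff₀ h3]; linarith, div_nonpos_of_nonpos_of_nonneg h2 h3.le⟩

/-- The pairs giving the main terms of the Eisenstein series on the arc. -/
def mainPairs : Finset (ℤ × ℤ) := {(0, 1), (0, -1), (1, 0), (-1, 0), (1, 1), (-1, -1)}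

lemma ne_zero_of_isCoprime_of_notMem_mainPairs {c d : ℤ} (h : IsCoprime c d)
    (hm : (c, d) ∉ mainPairs) : c ≠ 0 ∧ d ≠ 0 ∧ c - d ≠ 0 := by
  simp only [mainPairs, Finset.mem_insert, Finset.mem_singleton, Prod.mk.injEq, not_or] at hm
  refine ⟨?_, ?_, ?_⟩
  · rintro rfl
    rw [isCoprime_zero_left, Int.isUnit_iff] at h
    lia
  · rintro rfl
    rw [isCoprime_zero_right, Int.isUnit_iff] at h
    lia
  · intro h0
    obtain rfl : c = d := by lia
    rw [isCoprime_self, Int.isUnit_iff] at h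
    lia

/-- Since `-1 / 2 ≤ Re z ≤ 0`, the quadratic form is at least `(c - d) ^ 2 + d ^ 2` when `cd ≥ 0`
and at least `c ^ 2 + d ^ 2` when `cd ≤ 0`; then AM-GM. Products of two integers make the bounding
series factor into zeta values. -/
lemma two_mul_abs_le_or {θ : ℝ} (hθ : θ ∈ Set.Icc (Real.pi / 2) (3 * Real.pi / 4)) (c d : ℤ) :
    2 * |((c - d) * d : ℝ)| ≤ 2 * normSq (c * arcPoint θ + d) ∨
      2 * |(c * d : ℝ)| ≤ 2 * normSq (c * arcPoint θ + d) := by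
  rw [two_mul_normSq_arcPoint]
  obtain ⟨h1, h2⟩ := arcPoint_re_mem_Icc hθ
  rcases le_total 0 (c * d : ℝ) with h | h
  · left
    have : 2 * |((c - d) * d : ℝ)| ≤ (c - d) ^ 2 + d ^ 2 := by
      rw [← sq_abs (c - d : ℝ), ← sq_abs (d : ℝ), abs_mul]
      nlinarith [sq_nonneg (|(c - d : ℝ)| - |(d : ℝ)|)]
    nlinarith
  · right
    have : 2 * |(c * d : ℝ)| ≤ c ^ 2 + d ^ 2 := by
      rw [← sq_abs (c : ℝ), ← sq_abs (d : ℝ), abs_mul]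
      nlinarith [sq_nonneg (|(c : ℝ)| - |(d : ℝ)|)]
    nlinarith [mul_nonneg_of_nonpos_of_nonpos h h2, sq_nonneg (d : ℝ)]

lemma inv_pow_le_of_two_mul_abs_le {n : ℕ} (hn : 4 ≤ n) {a b : ℤ} {Q : ℝ} (ha : a ≠ 0)
    (hb : b ≠ 0) (hQ : 2 * |(a * b : ℝ)| ≤ Q) :
    (Q ^ n)⁻¹ ≤ 1 / 16 * (((a : ℝ) ^ 4)⁻¹ * ((b : ℝ) ^ 4)⁻¹) := by
  have h1 : (1 : ℝ) ≤ |(a * b : ℝ)| := by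
    have : 1 ≤ |a * b| := Int.one_le_abs (mul_ne_zero ha hb)
    exact_mod_cast this
  have h2 : (2 * |(a * b : ℝ)|) ^ 4 ≤ Q ^ n :=
    (pow_le_pow_left₀ (by positivity) hQ 4).trans (pow_le_pow_right₀ (by linarith) hn)
  have h3 : (2 * |(a * b : ℝ)|) ^ 4 = 16 * ((a : ℝ) ^ 4 * (b : ℝ) ^ 4) := by
    rw [mul_pow, ← mul_pow (a : ℝ), (even_iff_two_dvd.mpr (by norm_num)).pow_abs]
    norm_num
  rw [h3] at h2
  have ha' : (0 : ℝ) < (a : ℝ) ^ 4 := by positivity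
  have hb' : (0 : ℝ) < (b : ℝ) ^ 4 := by positivity
  calc (Q ^ n)⁻¹ ≤ (16 * ((a : ℝ) ^ 4 * (b : ℝ) ^ 4))⁻¹ := inv_anti₀ (by positivity) h2
    _ = _ := by field_simp

lemma norm_inv_pow_two_mul (w : ℂ) (n : ℕ) :
    ‖(w ^ (2 * n))⁻¹‖ = 2 ^ n * ((2 * normSq w) ^ n)⁻¹ := by
  rw [norm_inv, norm_pow, pow_mul, ← normSq_eq_norm_sq, mul_pow, mul_inv, ← mul_assoc,
    mul_inv_cancel₀ (by positivity), one_mul]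

/-- A summable bound for the remaining terms. -/
noncomputable def remainderBound (p : ℤ × ℤ) : ℝ :=
  1 / 16 * ((((p.1 - p.2 : ℤ) : ℝ) ^ 4)⁻¹ * ((p.2 : ℝ) ^ 4)⁻¹) +
    1 / 16 * (((p.1 : ℝ) ^ 4)⁻¹ * ((p.2 : ℝ) ^ 4)⁻¹)

lemma norm_coprimeSummand_le {n : ℕ} (hn : 4 ≤ n) {θ : ℝ}
    (hθ : θ ∈ Set.Icc (Real.pi / 2) (3 * Real.pi / 4)) {p : ℤ × ℤ} (hp : p ∉ mainPairs) :
    ‖coprimeSummand (2 * n) (arcPoint θ) p‖ ≤ 2 ^ n * remainderBound p := by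
  obtain ⟨c, d⟩ := p
  rw [coprimeSummand]
  have hpos1 : 0 ≤ 1 / 16 * ((((c - d : ℤ) : ℝ) ^ 4)⁻¹ * ((d : ℝ) ^ 4)⁻¹) := by positivity
  have hpos2 : 0 ≤ 1 / 16 * (((c : ℝ) ^ 4)⁻¹ * ((d : ℝ) ^ 4)⁻¹) := by positivity
  split_ifs with h
  · rw [norm_inv_pow_two_mul, remainderBound]
    gcongr
    obtain ⟨hc, hd, hcd⟩ := ne_zero_of_isCoprime_of_notMem_mainPairs h hp
    rcases two_mul_abs_le_or hθ c d with hQ | hQ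
    · have := inv_pow_le_of_two_mul_abs_le hn hcd hd (Q := 2 * normSq (c * arcPoint θ + d))
        (by rwa [Int.cast_sub])
      exact this.trans (le_add_of_nonneg_right hpos2)
    · have := inv_pow_le_of_two_mul_abs_le hn hc hd hQ
      exact this.trans (le_add_of_nonneg_left hpos1)
  · rw [norm_zero, remainderBound]
    positivity

/-- This is `2 ζ(4)`: the term at `n = 0` is `0`, since `0⁻¹ = 0`. -/
lemma hasSum_inv_int_pow_four : HasSum (fun n : ℤ ↦ ((n : ℝ) ^ 4)⁻¹) (Real.pi ^ 4 / 45) := by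
  have h := hasSum_zeta_four
  simp only [one_div] at h
  have h2 : HasSum (fun n : ℕ ↦ (((-(n : ℤ) : ℤ) : ℝ) ^ 4)⁻¹) (Real.pi ^ 4 / 90) := by
    refine h.congr_fun fun n ↦ ?_
    rw [Int.cast_neg, Int.cast_natCast, (by decide : Even 4).neg_pow]
  have h3 := HasSum.of_nat_of_neg (f := fun n : ℤ ↦ ((n : ℝ) ^ 4)⁻¹) (by simpa using h) h2
  convert! h3 using 1
  norm_num
  ring

lemma hasSum_remainderBound : HasSum remainderBound ((Real.pi ^ 4 / 45) ^ 2 / 8) := by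
  have hz := hasSum_inv_int_pow_four
  have h1 : HasSum (fun p : ℤ × ℤ ↦ ((p.1 : ℝ) ^ 4)⁻¹ * ((p.2 : ℝ) ^ 4)⁻¹)
      (Real.pi ^ 4 / 45 * (Real.pi ^ 4 / 45)) :=
    hz.mul hz (hz.summable.mul_of_nonneg hz.summable (fun _ ↦ by positivity)
      (fun _ ↦ by positivity))
  -- The shear `(c, d) ↦ (c - d, d)` turns the first half of the bound into the second.
  let e : ℤ × ℤ ≃ ℤ × ℤ :=
    { toFun := fun p ↦ (p.1 - p.2, p.2)
      invFun := fun p ↦ (p.1 + p.2, p.2)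
      left_inv := fun p ↦ by simp
      right_inv := fun p ↦ by simp }
  have h2 := e.hasSum_iff.mpr h1
  convert! (h2.mul_left (1 / 16)).add (h1.mul_left (1 / 16)) using 1
  ring

lemma remainderBound_total_le : (Real.pi ^ 4 / 45) ^ 2 / 8 ≤ 3 / 5 := by
  have h1 : Real.pi ^ 4 ≤ 3.15 ^ 4 :=
    pow_le_pow_left₀ Real.pi_pos.le (by linarith [Real.pi_lt_d2]) 4
  have h2 : Real.pi ^ 4 / 45 ≤ 2.188 := by
    rw [div_le_iff₀ (by norm_num)]
    exact h1.trans (by norm_num)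
  have h3 : 0 ≤ Real.pi ^ 4 / 45 := by positivity
  nlinarith

lemma sum_mainPairs (n : ℕ) (z : ℂ) :
    ∑ p ∈ mainPairs, coprimeSummand (2 * n) z p =
      2 * (1 + (z ^ (2 * n))⁻¹ + ((z + 1) ^ (2 * n))⁻¹) := by
  have he : Even (2 * n) := even_two_mul n
  have h1 : (-z - 1) ^ (2 * n) = (z + 1) ^ (2 * n) := by
    rw [show -z - 1 = -(z + 1) by ring, he.neg_pow]
  simp [mainPairs, coprimeSummand, isCoprime_one_left, isCoprime_one_right, IsCoprime.neg_left_iff,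
    IsCoprime.neg_right_iff, ← sub_eq_add_neg, h1, he.neg_pow]
  ring

/-- On the arc the Eisenstein series of weight `2n` is approximated by three of its terms. -/
theorem norm_eisensteinFun_sub_main_le {n : ℕ} (hk : 3 ≤ 2 * n) (hn : 4 ≤ n) {θ : ℝ}
    (hθ : θ ∈ Set.Icc (Real.pi / 2) (3 * Real.pi / 4)) :
    ‖eisensteinFun hk (arcPoint θ) - (1 + (arcPoint θ ^ (2 * n))⁻¹ +
      ((arcPoint θ + 1) ^ (2 * n))⁻¹)‖ ≤ 3 / 10 * 2 ^ n := by
  have h1 := hasSum_coprimeSummand hk (arcPoint_im_pos hθ)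
  set f := coprimeSummand (2 * n) (arcPoint θ)
  have h2 : HasSum (fun p ↦ if p ∈ mainPairs then f p else 0) (∑ p ∈ mainPairs, f p) := by
    have := hasSum_sum_of_ne_finset_zero (f := fun p ↦ if p ∈ mainPairs then f p else 0)
      (s := mainPairs) (L := SummationFilter.unconditional _) (fun p hp ↦ if_neg hp)
    rwa [Finset.sum_congr rfl fun p hp ↦ if_pos hp] at this
  have h3 := h1.sub h2
  have h4 : ‖2 * eisensteinFun hk (arcPoint θ) - ∑ p ∈ mainPairs, f p‖ ≤
      2 ^ n * ((Real.pi ^ 4 / 45) ^ 2 / 8) := by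
    rw [← h3.tsum_eq]
    refine tsum_of_norm_bounded (hasSum_remainderBound.mul_left _) fun p ↦ ?_
    by_cases hp : p ∈ mainPairs
    · simp only [hp, if_true, sub_self, norm_zero]
      unfold remainderBound
      positivity
    · simpa [hp] using norm_coprimeSummand_le hn hθ hp
  rw [sum_mainPairs, ← mul_sub, norm_mul] at h4
  have h5 : (0 : ℝ) < 2 ^ n := by positivity
  have h6 := mul_le_mul_of_nonneg_left remainderBound_total_le h5.le
  norm_num at h4
  linarith

/-! ### Sign changes on the arc -/

/-- The real-valued function `Re (e ^ (inθ) E_{2n}(e ^ (iθ) / √2))`, whose zeros are the zeros of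
the Fricke Eisenstein series on the arc. -/
noncomputable def arcRealPart {n : ℕ} (hk : 3 ≤ 2 * n) (θ : ℝ) : ℝ :=
  (exp (n * θ * I) * eisensteinFun hk (arcPoint θ)).re

lemma continuousOn_arcRealPart {n : ℕ} (hk : 3 ≤ 2 * n) :
    ContinuousOn (arcRealPart hk) (Set.Icc (Real.pi / 2) (3 * Real.pi / 4)) := by
  refine continuous_re.comp_continuousOn (ContinuousOn.mul (by fun_prop) ?_)
  exact (differentiableOn_eisensteinFun hk).continuousOn.comp continuous_arcPoint.continuousOn
    fun θ hθ ↦ arcPoint_im_pos hθ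

lemma two_pow_mul_arcPoint_pow (n : ℕ) (θ : ℝ) :
    2 ^ n * arcPoint θ ^ (2 * n) = exp (n * θ * I) ^ 2 := by
  rw [pow_mul, ← mul_pow, IsFrickeForm.two_mul_arcPoint_sq, ← exp_nat_mul, ← exp_nat_mul]
  congr 1
  push_cast
  ring

/-- On the arc `2z = -1 / (-conj z)`, so modularity and the conjugation symmetry show that `2 ^ n *
E(2z)`, multiplied by `e ^ (inθ)`, is the conjugate of `e ^ (inθ) * E(z)`. The sum is then twice a
real part. -/
lemma exp_mul_frickeEisensteinFun_arcPoint {n : ℕ} (hk : 3 ≤ 2 * n) {θ : ℝ}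
    (hθ : θ ∈ Set.Icc (Real.pi / 2) (3 * Real.pi / 4)) :
    exp (n * θ * I) * (frickeEisensteinFun hk (arcPoint θ) * (2 ^ n + 1)) =
      2 * arcRealPart hk θ := by
  have him := arcPoint_im_pos hθ
  set z := arcPoint θ with hz
  set e := exp (n * θ * I) with he
  have he1 : e * starRingEnd ℂ e = 1 := by
    rw [mul_conj, normSq_eq_norm_sq, he, show (n * θ * I : ℂ) = ((n * θ : ℝ) : ℂ) * I by
      push_cast; ring, norm_exp_ofReal_mul_I]
    norm_num
  have hinv : 2 * z = -1 / (-starRingEnd ℂ z) := by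
    have hz0 : starRingEnd ℂ z ≠ 0 := by
      intro h0
      have := congrArg Complex.im h0
      simp only [conj_im, zero_im] at this
      linarith
    rw [neg_div_neg_eq, eq_div_iff hz0, mul_assoc, mul_conj, normSq_arcPoint]
    norm_num
  have h2 : eisensteinFun hk (2 * z) =
      starRingEnd ℂ z ^ (2 * n) * starRingEnd ℂ (eisensteinFun hk z) := by
    rw [hinv, eisensteinFun_neg_one_div hk (by simpa using him), eisensteinFun_neg_conj hk him,
      (even_two_mul n).neg_pow]
  have h3 : 2 ^ n * starRingEnd ℂ z ^ (2 * n) = starRingEnd ℂ e ^ 2 := by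
    have := congrArg (starRingEnd ℂ) (two_pow_mul_arcPoint_pow n θ)
    simpa only [map_mul, map_pow, conj_ofNat] using this
  have h4 : (2 * n) / 2 = n := by lia
  rw [frickeEisensteinFun, h4, div_mul_cancel₀ _ (two_pow_add_one_ne_zero n), h2, ← mul_assoc,
    h3, arcRealPart, re_eq_add_conj, map_mul]
  linear_combination (starRingEnd ℂ e * starRingEnd ℂ (eisensteinFun hk z)) * he1

lemma frickeEisensteinFun_arcPoint_eq_zero {n : ℕ} (hk : 3 ≤ 2 * n) {θ : ℝ}
    (hθ : θ ∈ Set.Icc (Real.pi / 2) (3 * Real.pi / 4)) (h0 : arcRealPart hk θ = 0) :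
    frickeEisensteinFun hk (arcPoint θ) = 0 := by
  have h := exp_mul_frickeEisensteinFun_arcPoint hk hθ
  rw [h0, ofReal_zero, mul_zero] at h
  have h1 := (mul_eq_zero.mp h).resolve_left (exp_ne_zero _)
  exact (mul_eq_zero.mp h1).resolve_right (two_pow_add_one_ne_zero n)

/-- At `θ = jπ / n` the term `z ^ (-2n)` is exactly `2 ^ n`. The third term costs at most half of
that and the remainder at most three tenths, so a positive quantity is left. -/
lemma arcRealPart_mul_pos {n : ℕ} (hk : 3 ≤ 2 * n) (hn : 4 ≤ n) {θ : ℝ}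
    (hθ : θ ∈ Set.Icc (Real.pi / 2) (3 * Real.pi / 4)) {j : ℕ} (hj : n * θ = j * Real.pi)
    (hre : -(1 / 2) * 2 ^ n ≤ ((arcPoint θ + 1) ^ (2 * n))⁻¹.re) :
    0 < (-1) ^ j * arcRealPart hk θ := by
  have he : exp (n * θ * I) = (((-1) ^ j : ℝ) : ℂ) := by
    rw [show (n * θ * I : ℂ) = (j : ℕ) * (Real.pi * I) by
      rw [← mul_assoc]
      congr 1
      exact_mod_cast hj, exp_nat_mul, exp_pi_mul_I]
    push_cast
    rfl
  have hsq : ((-1 : ℝ) ^ j) * (-1) ^ j = 1 := by rw [← mul_pow]; norm_num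
  have hz : (arcPoint θ ^ (2 * n))⁻¹ = ((2 ^ n : ℝ) : ℂ) := by
    have h := two_pow_mul_arcPoint_pow n θ
    rw [he, ← ofReal_pow, sq, hsq, ofReal_one] at h
    rw [ofReal_pow, ofReal_ofNat]
    exact inv_eq_of_mul_eq_one_left h
  have h := norm_eisensteinFun_sub_main_le hk hn hθ
  rw [hz] at h
  have h' := (abs_le.mp ((abs_re_le_norm _).trans h)).1
  simp only [sub_re, add_re, one_re, ofReal_re] at h'
  rw [arcRealPart, he, re_ofReal_mul, ← mul_assoc, hsq, one_mul]
  have : (0 : ℝ) < 2 ^ n := by positivity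
  linarith

/-- The term `(z + 1) ^ (-2n)` reaches size `2 ^ n` at the end `3π / 4`. At distance `π / (4n)` from
it, Jordan's inequality gives `2 |z + 1| ^ 2 ≥ 1 + 1 / n`, and Bernoulli's inequality then halves
the term. -/
lemma le_re_inv_pow_of_le {n : ℕ} (hn : 4 ≤ n) {θ : ℝ}
    (hθ : θ ∈ Set.Icc (Real.pi / 2) (3 * Real.pi / 4))
    (hθ' : θ ≤ 3 * Real.pi / 4 - Real.pi / (4 * n)) :
    -(1 / 2) * 2 ^ n ≤ ((arcPoint θ + 1) ^ (2 * n))⁻¹.re := by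
  have hn0 : (0 : ℝ) < n := by positivity
  obtain ⟨δ, hδ⟩ : ∃ δ, δ = 3 * Real.pi / 4 - θ := ⟨_, rfl⟩
  have hδ1 : Real.pi / (4 * n) ≤ δ := by linarith
  have hδ0 : 0 ≤ δ := le_trans (by positivity) hδ1
  have hδ2 : δ ≤ Real.pi / 2 := by linarith [hθ.1, Real.pi_pos]
  have hcos : (arcPoint θ).re = -(Real.cos δ / 2) + Real.sin δ / 2 := by
    rw [arcPoint_re, show θ = 3 * Real.pi / 4 - δ by linarith, Real.cos_sub,
      cos_three_pi_div_four, sin_three_pi_div_four]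
    field_simp
  have hQ : 2 * normSq (arcPoint θ + 1) = 3 - 2 * Real.cos δ + 2 * Real.sin δ := by
    have := two_mul_normSq_arcPoint θ 1 1
    norm_num at this
    rw [this, hcos]
    ring
  have hsin : 1 / n ≤ 2 * Real.sin δ := by
    have h1 := Real.mul_le_sin hδ0 hδ2
    have h2 : 2 / Real.pi * (Real.pi / (4 * n)) ≤ 2 / Real.pi * δ := by
      gcongr
    have h3 : 2 / Real.pi * (Real.pi / (4 * n)) = 1 / n / 2 := by
      have := Real.pi_ne_zero
      field_simp
      norm_num
    linarith
  have hQ1 : 1 + 1 / (n : ℝ) ≤ 2 * normSq (arcPoint θ + 1) := by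
    rw [hQ]
    linarith [Real.cos_le_one δ]
  have hQ2 : 2 ≤ (2 * normSq (arcPoint θ + 1)) ^ n := by
    have h1 := one_add_mul_le_pow (a := 1 / (n : ℝ))
      (le_trans (by norm_num) (by positivity : (0 : ℝ) ≤ 1 / n)) n
    rw [mul_one_div_cancel hn0.ne'] at h1
    calc (2 : ℝ) = 1 + 1 := by norm_num
      _ ≤ _ := h1
      _ ≤ _ := pow_le_pow_left₀ (by positivity) hQ1 n
  have h := (abs_le.mp (abs_re_le_norm ((arcPoint θ + 1) ^ (2 * n))⁻¹)).1
  rw [norm_inv_pow_two_mul] at h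
  have h2 : ((2 * normSq (arcPoint θ + 1)) ^ n)⁻¹ ≤ 1 / 2 := by
    rw [inv_eq_one_div]
    exact one_div_le_one_div_of_le two_pos hQ2
  have h3 := mul_le_mul_of_nonneg_left h2 (by positivity : (0 : ℝ) ≤ 2 ^ n)
  linarith

/-- At the end itself the term is as large as `2 ^ n`, but for `4 ∣ n` it is a positive real,
because `((1 + i) / 2) ^ 8 = 1 / 16`. -/
lemma le_re_inv_pow_three_pi_div_four {n : ℕ} (hn : 4 ∣ n) :
    -(1 / 2) * 2 ^ n ≤ ((arcPoint (3 * Real.pi / 4) + 1) ^ (2 * n))⁻¹.re := by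
  obtain ⟨m, rfl⟩ := hn
  have hz : arcPoint (3 * Real.pi / 4) + 1 = (1 + I) / 2 := by
    have h2 : √2 * √2 = (2 : ℝ) := Real.mul_self_sqrt zero_le_two
    apply Complex.ext
    · simp only [add_re, arcPoint_re, cos_three_pi_div_four, one_re]
      simp
      field_simp
      norm_num
    · simp only [add_im, arcPoint_im, sin_three_pi_div_four, one_im]
      simp
      field_simp
  have h4 : ((1 + I) / 2) ^ 8 = ((1 / 16 : ℝ) : ℂ) := by
    have : ((1 + I) / 2) ^ 2 = I / 2 := by
      linear_combination (1 / 4 : ℂ) * I_sq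
    rw [show 8 = 2 * 4 from rfl, pow_mul, this, div_pow, I_pow_four]
    norm_num
  rw [hz, show 2 * (4 * m) = 8 * m by ring, pow_mul ((1 + I) / 2), h4, ← ofReal_pow, ← ofReal_inv,
    ofReal_re]
  exact le_trans (by simp) (by positivity : (0 : ℝ) ≤ ((1 / 16 : ℝ) ^ m)⁻¹)

/-- A continuous function with alternating signs at `θ i₀ < ⋯ < θ i₁` has `i₁ - i₀` zeros. -/
lemma exists_finset_zeros_of_alternating {A : ℝ → ℝ} {θ : ℕ → ℝ} (hθ : StrictMono θ) {i₀ i₁ : ℕ}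
    (hi : i₀ ≤ i₁) (hA : ContinuousOn A (Set.Icc (θ i₀) (θ i₁)))
    (hsign : ∀ j, i₀ ≤ j → j ≤ i₁ → 0 < (-1) ^ j * A (θ j)) :
    ∃ Z : Finset ℝ, Z.card = i₁ - i₀ ∧ ∀ x ∈ Z, x ∈ Set.Ioo (θ i₀) (θ i₁) ∧ A x = 0 := by
  induction i₁, hi using Nat.le_induction with
  | base => exact ⟨∅, by simp⟩
  | succ i hi ih =>
    have hlt := hθ (Nat.lt_succ_self i)
    have hle := hθ.monotone hi
    obtain ⟨Z, hcard, hZ⟩ := ih (hA.mono (Set.Icc_subset_Icc_right hlt.le))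
      fun j h1 h2 ↦ hsign j h1 (h2.trans i.le_succ)
    have s0 := hsign i hi i.le_succ
    have s1 := hsign (i + 1) (hi.trans i.le_succ) le_rfl
    obtain ⟨x, hx, hx0⟩ : ∃ x ∈ Set.Icc (θ i) (θ (i + 1)), A x = 0 := by
      have hc := hA.mono (Set.Icc_subset_Icc_left hle)
      rw [pow_succ] at s1
      rcases neg_one_pow_eq_or ℝ i with h | h
      · rw [h] at s0 s1
        exact intermediate_value_Icc' hlt.le hc ⟨by linarith, by linarith⟩
      · rw [h] at s0 s1
        exact intermediate_value_Icc hlt.le hc ⟨by linarith, by linarith⟩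
    have hx1 : θ i < x := hx.1.lt_of_ne fun h ↦ by rw [h, hx0, mul_zero] at s0; exact lt_irrefl _ s0
    have hx2 : x < θ (i + 1) := hx.2.lt_of_ne fun h ↦ by
      rw [← h, hx0, mul_zero] at s1; exact lt_irrefl _ s1
    have hnot : x ∉ Z := fun h ↦ (hx1.trans ((hZ x h).1.2)).false
    refine ⟨insert x Z, by rw [Finset.card_insert_of_notMem hnot, hcard]; lia, fun y hy ↦ ?_⟩
    rcases Finset.mem_insert.mp hy with rfl | hy
    · exact ⟨⟨hle.trans_lt hx1, hx2⟩, hx0⟩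
    · exact ⟨⟨(hZ y hy).1.1, (hZ y hy).1.2.trans hlt⟩, (hZ y hy).2⟩

/-- The Fricke Eisenstein series of weight `2n` has at least `i₁ - i₀` zeros in the interior of the
arc if `n / 2 ≤ i₀ ≤ i₁ ≤ 3n / 4`. -/
theorem exists_finset_zeros_frickeEisensteinFun {n : ℕ} (hk : 3 ≤ 2 * n) (hn : 4 ≤ n) {i₀ i₁ : ℕ}
    (hi : i₀ ≤ i₁) (h₀ : n ≤ 2 * i₀) (h₁ : 4 * i₁ ≤ 3 * n) :
    ∃ Z : Finset ℝ, Z.card = i₁ - i₀ ∧ ∀ θ ∈ Z, θ ∈ Set.Ioo (Real.pi / 2) (3 * Real.pi / 4) ∧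
      frickeEisensteinFun hk (arcPoint θ) = 0 := by
  have hn0 : (0 : ℝ) < n := by positivity
  have hpi := Real.pi_pos
  let t : ℕ → ℝ := fun j ↦ j * Real.pi / n
  have ht : StrictMono t := fun a b hab ↦ by
    have : (a : ℝ) < b := by exact_mod_cast hab
    simp only [t]
    gcongr
  have ht0 : Real.pi / 2 ≤ t i₀ := by
    have : (n : ℝ) ≤ 2 * i₀ := by exact_mod_cast h₀
    simp only [t]
    rw [div_le_div_iff₀ two_pos hn0]
    nlinarith
  have ht1 : t i₁ ≤ 3 * Real.pi / 4 := by
    have : (4 : ℝ) * i₁ ≤ 3 * n := by exact_mod_cast h₁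
    simp only [t]
    rw [div_le_div_iff₀ hn0 (by norm_num)]
    nlinarith
  have hsub : Set.Icc (t i₀) (t i₁) ⊆ Set.Icc (Real.pi / 2) (3 * Real.pi / 4) :=
    Set.Icc_subset_Icc ht0 ht1
  obtain ⟨Z, hcard, hZ⟩ := exists_finset_zeros_of_alternating ht hi
    ((continuousOn_arcRealPart hk).mono hsub) fun j hj0 hj1 ↦ by
      have hmem : t j ∈ Set.Icc (Real.pi / 2) (3 * Real.pi / 4) :=
        hsub ⟨ht.monotone hj0, ht.monotone hj1⟩
      refine arcRealPart_mul_pos hk hn hmem (by simp only [t]; field_simp) ?_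
      -- By integrality a sample angle `jπ / n` below `3π / 4` is at least `π / (4n)` below it;
      -- equality `4j = 3n` forces `4 ∣ n`.
      rcases Nat.lt_or_ge (4 * j) (3 * n) with hlt | hge
      · refine le_re_inv_pow_of_le hn hmem ?_
        have : (4 * j : ℝ) + 1 ≤ 3 * n := by exact_mod_cast hlt
        have e : 3 * Real.pi / 4 - Real.pi / (4 * n) = ((3 * n - 1) / 4) * Real.pi / n := by
          field_simp
        rw [e]
        simp only [t]
        gcongr
        linarith
      · have heq : 4 * j = 3 * n := by lia
        have e : t j = 3 * Real.pi / 4 := by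
          have : (4 * j : ℝ) = 3 * n := by exact_mod_cast heq
          simp only [t]
          field_simp
          linarith
        rw [e]
        exact le_re_inv_pow_three_pi_div_four (by lia)
  refine ⟨Z, hcard, fun θ hθ ↦ ?_⟩
  obtain ⟨hm, h0⟩ := hZ θ hθ
  exact ⟨⟨ht0.trans_lt hm.1, hm.2.trans_le ht1⟩,
    frickeEisensteinFun_arcPoint_eq_zero hk (hsub (Set.Ioo_subset_Icc_self hm)) h0⟩

/-! ### Counting zeros in every weight -/

lemma pi_div_two_mem_arc : Real.pi / 2 ∈ Set.Icc (Real.pi / 2) (3 * Real.pi / 4) :=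
  ⟨le_rfl, by linarith [Real.pi_pos]⟩

lemma three_pi_div_four_mem_arc :
    3 * Real.pi / 4 ∈ Set.Icc (Real.pi / 2) (3 * Real.pi / 4) :=
  ⟨by linarith [Real.pi_pos], le_rfl⟩

lemma isFrickeForm_of_two_mul {n : ℕ} (hk : 3 ≤ 2 * n) :
    IsFrickeForm n (frickeEisensteinFun hk) := by
  have := isFrickeForm_frickeEisensteinFun hk (even_two_mul n)
  rwa [show 2 * n / 2 = n by lia] at this

/-- If a form vanishes at a zero of the Fricke Eisenstein series, has complementary weight, and
vanishes together with it at enough points of the arc, the zero lies over `|x| = 64`. -/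
lemma norm_etaQuotient_eq_of_mul {n h m : ℕ} (hk : 3 ≤ 2 * n) {g : ℂ → ℂ} (hg : IsFrickeForm h g)
    (hm : n + h = 4 * m) (Z : Finset ℝ)
    (hZ : ∀ θ ∈ Z, θ ∈ Set.Ioo (Real.pi / 2) (3 * Real.pi / 4) ∧
      frickeEisensteinFun hk (arcPoint θ) = 0) (S : Finset ℝ)
    (hS : S ⊆ {Real.pi / 2, 3 * Real.pi / 4})
    (hSzero : ∀ θ ∈ S, frickeEisensteinFun hk (arcPoint θ) * g (arcPoint θ) = 0)
    (hcard : m ≤ Z.card + S.card) {w : ℂ} (hw : 0 < w.im) (h0 : frickeEisensteinFun hk w = 0) :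
    ‖etaQuotient w‖ = 64 := by
  have hform := (isFrickeForm_of_two_mul hk).mul hg
  rw [hm] at hform
  have hS' {θ : ℝ} (hθ : θ ∈ S) : θ = Real.pi / 2 ∨ θ = 3 * Real.pi / 4 := by
    simpa using hS hθ
  refine hform.norm_etaQuotient_eq_of_eq_zero (Z ∪ S) (fun θ hθ ↦ ?_) ?_ (fun θ hθ ↦ ?_) hw
    (by rw [h0, zero_mul])
  · rcases Finset.mem_union.mp hθ with hθ | hθ
    · exact Set.Ioo_subset_Icc_self (hZ θ hθ).1
    · rcases hS' hθ with rfl | rfl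
      exacts [pi_div_two_mem_arc, three_pi_div_four_mem_arc]
  · rw [Finset.card_union_of_disjoint]
    · exact hcard
    · rw [Finset.disjoint_left]
      intro θ hθZ hθS
      have := (hZ θ hθZ).1
      rcases hS' hθS with rfl | rfl
      exacts [this.1.false, this.2.false]
  · rcases Finset.mem_union.mp hθ with hθ | hθ
    · rw [(hZ θ hθ).2, zero_mul]
    · exact hSzero θ hθ

lemma card_pi_div_two_three_pi_div_four :
    ({Real.pi / 2, 3 * Real.pi / 4} : Finset ℝ).card = 2 :=
  Finset.card_pair (by linarith [Real.pi_pos])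

/-- The Hauptmodul takes values in `[-128, 128]` at all zeros of the Fricke Eisenstein series, so
`|η(w) / η(2w)| ^ 24 = 64` there. -/
theorem norm_etaQuotient_eq_of_frickeEisensteinFun_eq_zero {n : ℕ} (hk : 3 ≤ 2 * n) {w : ℂ}
    (hw : 0 < w.im) (h0 : frickeEisensteinFun hk w = 0) : ‖etaQuotient w‖ = 64 := by
  have hf := isFrickeForm_of_two_mul hk
  have h4 := isFrickeForm_of_two_mul (n := 2) (by norm_num)
  have h6 := isFrickeForm_of_two_mul (n := 3) (by norm_num)
  have h1 : IsFrickeForm 0 (fun _ ↦ 1) :=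
    ⟨differentiableOn_const _, fun _ _ ↦ rfl, fun _ _ ↦ by simp, tendsto_const_nhds⟩
  have key (i₀ i₁ : ℕ) (h₀ : n ≤ 2 * i₀) (h₁ : 4 * i₁ ≤ 3 * n) : ∃ Z : Finset ℝ,
      Z.card = i₁ - i₀ ∧ ∀ θ ∈ Z, θ ∈ Set.Ioo (Real.pi / 2) (3 * Real.pi / 4) ∧
        frickeEisensteinFun hk (arcPoint θ) = 0 := by
    -- If `i₀ < i₁`, the two bounds force `n ≥ 4`, as the estimates require. Otherwise the truncated
    -- difference is `0` and no interior zero is claimed, so small weights rely on the forced zeros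
    -- alone.
    by_cases hi : i₀ < i₁
    · exact exists_finset_zeros_frickeEisensteinFun hk (by lia) hi.le h₀ h₁
    · exact ⟨∅, by simp; lia, by simp⟩
  -- For `n ≡ 0, 1, 2, 3` modulo `4` the auxiliary factor is `1`, `E*_6`, `E*_4`, `E*_4 * E*_6`. The
  -- points needed number `m`, `m + 1`, `m + 1`, `m + 2`, and `0`, `2`, `1`, `2` of them are ends of
  -- the arc.
  obtain ⟨m, hm | hm | hm | hm⟩ :
      ∃ m, n = 4 * m ∨ n = 4 * m + 1 ∨ n = 4 * m + 2 ∨ n = 4 * m + 3 := ⟨n / 4, by lia⟩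
  · obtain ⟨Z, hcard, hZ⟩ := key (2 * m) (3 * m) (by lia) (by lia)
    exact norm_etaQuotient_eq_of_mul hk h1 (m := m) (by lia) Z hZ ∅ (by simp) (by simp)
      (by rw [hcard]; lia) hw h0
  · obtain ⟨Z, hcard, hZ⟩ := key (2 * m + 1) (3 * m) (by lia) (by lia)
    refine norm_etaQuotient_eq_of_mul hk h6 (m := m + 1) (by lia) Z hZ _ subset_rfl
      (fun θ hθ ↦ ?_) (by rw [hcard, card_pi_div_two_three_pi_div_four]; lia) hw h0
    rcases (by simpa using hθ : θ = Real.pi / 2 ∨ θ = 3 * Real.pi / 4) with rfl | rfl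
    · rw [hf.eq_zero_at_pi_div_two (by rw [Nat.odd_iff]; lia), zero_mul]
    · rw [hf.eq_zero_at_three_pi_div_four (by lia), zero_mul]
  · obtain ⟨Z, hcard, hZ⟩ := key (2 * m + 1) (3 * m + 1) (by lia) (by lia)
    refine norm_etaQuotient_eq_of_mul hk h4 (m := m + 1) (by lia) Z hZ {3 * Real.pi / 4}
      (by simp) (fun θ hθ ↦ ?_) (by rw [hcard, Finset.card_singleton]; lia) hw h0
    obtain rfl := Finset.mem_singleton.mp hθ
    rw [hf.eq_zero_at_three_pi_div_four (by lia), zero_mul]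
  · obtain ⟨Z, hcard, hZ⟩ := key (2 * m + 2) (3 * m + 2) (by lia) (by lia)
    refine norm_etaQuotient_eq_of_mul hk (h4.mul h6) (m := m + 2) (by lia) Z hZ _ subset_rfl
      (fun θ hθ ↦ ?_) (by rw [hcard, card_pi_div_two_three_pi_div_four]; lia) hw h0
    rcases (by simpa using hθ : θ = Real.pi / 2 ∨ θ = 3 * Real.pi / 4) with rfl | rfl
    · rw [hf.eq_zero_at_pi_div_two (by rw [Nat.odd_iff]; lia), zero_mul]
    · rw [hf.eq_zero_at_three_pi_div_four (by lia), zero_mul]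

lemma inv_sqrt_two_sq : (1 / √2 : ℝ) ^ 2 = 1 / 2 := by
  rw [div_pow, one_pow, Real.sq_sqrt zero_le_two]

lemma mem_frickeArc_of_norm_eq {z : ℂ} (him : 0 < z.im) (hnorm : ‖z‖ = 1 / √2)
    (hre : z.re ∈ Set.Icc (-1 / 2) 0) : z ∈ frickeArc := by
  have hpi := Real.pi_pos
  have hz0 : z ≠ 0 := by rintro rfl; simp at him
  have hcos : Real.cos z.arg = √2 * z.re := by
    rw [cos_arg hz0, hnorm]
    field_simp
  have harg0 : 0 ≤ z.arg := arg_nonneg_iff.mpr him.le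
  have hs : (0 : ℝ) < √2 := by positivity
  refine ⟨hnorm, ?_, ?_⟩
  · by_contra! hlt
    have := Real.cos_pos_of_mem_Ioo ⟨by linarith, hlt⟩
    rw [hcos] at this
    nlinarith [hre.2]
  · by_contra! hlt
    have := Real.cos_lt_cos_of_nonneg_of_le_pi (by positivity) (arg_le_pi z) hlt
    rw [hcos, cos_three_pi_div_four] at this
    nlinarith [hre.1]

theorem theorem1 (k : ℕ) (hk : 4 ≤ k) (hk_even : Even k) (z : ℍ) (hz : z ∈ frickeDomain)
    (hzero : frickeEisenstein (show 3 ≤ k by omega) z = 0) : (z : ℂ) ∈ frickeArc := by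
  obtain ⟨n, rfl⟩ := even_iff_exists_two_mul.mp hk_even
  rw [frickeEisenstein_eq] at hzero
  have hx := norm_etaQuotient_eq_of_frickeEisensteinFun_eq_zero _ z.im_pos hzero
  have habove (hre : |(z : ℂ).re| ≤ 1 / 2) : ¬ 1 / √2 < ‖(z : ℂ)‖ := by
    intro hlt
    have h1 : 1 / 2 < normSq z := by
      rw [normSq_eq_norm_sq, ← inv_sqrt_two_sq]
      exact pow_lt_pow_left₀ hlt (by positivity) two_ne_zero
    exact (lt_norm_etaQuotient z.im_pos hre h1).ne' hx
  rcases hz with ⟨h1, h2, h3⟩ | ⟨h1, h2, h3⟩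
  · have h2' : -1 / 2 ≤ (z : ℂ).re := h2
    have h3' : (z : ℂ).re ≤ 0 := h3
    have hnot := habove (abs_le.mpr ⟨by linarith, by linarith⟩)
    exact mem_frickeArc_of_norm_eq z.im_pos (le_antisymm (not_lt.mp hnot) h1) ⟨h2', h3'⟩
  · have h2' : 0 ≤ (z : ℂ).re := h2
    have h3' : (z : ℂ).re < 1 / 2 := h3
    exact absurd h1 (habove (abs_le.mpr ⟨by linarith, by linarith⟩))
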